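/- Let $n\ge 1$ and $0\le K\le n$ be integers, $J=n-K$ and $\sigma>0$. Consider the measurement model $Y=BX+N$, where $X\sim\mathcal N(0,I_n)$ and $N\sim\mathcal N(0,\sigma^2 I_n)$ are independent, and $B=\mathrm{diag}(B_1,\dots,B_n)$ with $B_i\in\{0,1\}$ and $\sum_{i=1}^n B_i=K$ is a random matrix independent of $(X,N)$ whose support is uniformly distributed: $\mathbb P(\{i: B_i=1\}=S)=1/\binom nK$ for every $S\subset\{1,\dots,n\}$ with $|S|=K$. Let $$\mathrm{mmse}=\mathrm{mmse}(n,K,\sigma)=\mathbb E\Big[\big(\|X\|-\mathbb E[\|X\|\mid Y]\big)^2\Big]$$ be the mean square error of the MMSE estimator $\mathbb E[\|X\|\mid Y]$ of the Euclidean norm $\|X\|$. Write $B(a,b)=\Gamma(a)\Gamma(b)/\Gamma(a+b)$ for the beta function and ${}_3F_2(a_1,a_2,a_3;b_1,b_2;x)=\sum_{k\ge 0}\frac{(a_1)_k(a_2)_k(a_3)_k}{(b_1)_k(b_2)_k}\frac{x^k}{k!}$ for the hypergeometric series, with $(a)_0=1$ and $(a)_k=a(a+1)\cdots(a+k-1)$.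 Then: 1. For fixed $n$ and $K$, the series below converges and $$\lim_{\sigma\to 0^+}\mathrm{mmse}=n-(n+J)\,\frac{B\left(\frac{n+J}{2},\frac{n+1}{2}\right)}{B\left(\frac{n+J+1}{2},\frac n2\right)}\;{}_3F_2\left(\frac{n+1}{2},\frac J2,-\frac12;\frac{n+J+1}{2},\frac n2;1\right).$$ 2. For fixed $n$ and $K$, $$\lim_{\sigma\to\infty}\mathrm{mmse}=n-2\left(\frac{\Gamma\left(\frac{n+1}{2}\right)}{\Gamma\left(\frac n2\right)}\right)^2 .$$ 3. For fixed $\sigma>0$ and any sequences of integers $n_j\to\infty$ and $1\le K_j\le n_j$ (that is, $K_j/n_j\in[1/n_j,1]$; in particular whenever $K_j/n_j=p$ is a constant), $$\lim_{j\to\infty}\frac{\mathrm{mmse}(n_j,K_j,\sigma)}{n_j}=0 .$$ -/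

import Mathlib

open MeasureTheory ProbabilityTheory Filter Topology

universe u

noncomputable section

/-- The `k`-th term `(a₁)_k ⋯ (a_p)_k / ((b₁)_k ⋯ (b_q)_k) * x ^ k / k!` of the generalized
hypergeometric series, where `(c)_k = c (c + 1) ⋯ (c + k - 1)`. -/
def hypergeometricTerm (a b : List ℝ) (x : ℝ) (k : ℕ) : ℝ :=
  (a.map fun c => (ascPochhammer ℝ k).eval c).prod /
      (b.map fun c => (ascPochhammer ℝ k).eval c).prod *
    (x ^ k / (k.factorial : ℝ))

/-- The generalized hypergeometric function `_pF_q(a₁, …, a_p; b₁, …, b_q; x)`. -/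
def hypergeometricPFQ (a b : List ℝ) (x : ℝ) : ℝ :=
  ∑' k : ℕ, hypergeometricTerm a b x k

/-- The random vectors of the measurement model `Y = B X + N`, on an arbitrary probability space:
`X ∼ 𝒩(0, I_n)`, `N ∼ 𝒩(0, σ² I_n)` and `B = diag(B₁, …, B_n)` with `B_i ∈ {0, 1}` and
`∑ B_i = K`; `X` and `N` are independent, `B` is independent of `(X, N)`, and the support of
`B` is uniform among the `K`-element subsets of the index set. -/
structure MeasurementModel (n K : ℕ) (σ : ℝ) where
  /-- the sample space -/
  Ω : Type u
  /-- the events -/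
  [measurableSpace : MeasurableSpace Ω]
  /-- the probability -/
  P : Measure Ω
  [isProbabilityMeasure : IsProbabilityMeasure P]
  /-- the input vector -/
  X : Ω → EuclideanSpace ℝ (Fin n)
  /-- the noise vector -/
  N : Ω → EuclideanSpace ℝ (Fin n)
  /-- the diagonal entries `B₁, …, B_n` of `B` -/
  b : Ω → Fin n → ℝ
  measurable_X : Measurable X
  measurable_N : Measurable N
  measurable_b : Measurable b
  law_X : P.map X = multivariateGaussian 0 (1 : Matrix (Fin n) (Fin n) ℝ)
  law_N : P.map N = multivariateGaussian 0 (σ ^ 2 • (1 : Matrix (Fin n) (Fin n) ℝ))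
  b_zero_or_one : ∀ ω i, b ω i = 0 ∨ b ω i = 1
  sum_b : ∀ ω, ∑ i, b ω i = K
  prob_support_b : ∀ S : Finset (Fin n), S.card = K →
    P {ω | Function.support (b ω) = (S : Set (Fin n))} = 1 / (n.choose K : ENNReal)
  indep_X_N : IndepFun X N P
  indep_b_XN : IndepFun b (fun ω => (X ω, N ω)) P

namespace MeasurementModel

attribute [instance] MeasurementModel.measurableSpace MeasurementModel.isProbabilityMeasure

variable {n K : ℕ} {σ : ℝ}

/-- The measurement `Y = B X + N`. -/
def Y (M : MeasurementModel.{u} n K σ) (ω : M.Ω) : EuclideanSpace ℝ (Fin n) :=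
  Matrix.toEuclideanLin (Matrix.diagonal (M.b ω)) (M.X ω) + M.N ω

/-- The MMSE estimator `E[‖X‖ | Y]` of the Euclidean norm of the input. -/
def estimator (M : MeasurementModel.{u} n K σ) : M.Ω → ℝ :=
  M.P[fun ω => ‖M.X ω‖ | MeasurableSpace.comap M.Y inferInstance]

/-- The mean square error `E[(‖X‖ - E[‖X‖ | Y])²]` of the MMSE estimator. -/
def mmse (M : MeasurementModel.{u} n K σ) : ℝ :=
  ∫ ω, (‖M.X ω‖ - M.estimator ω) ^ 2 ∂M.P

end MeasurementModel

end

/-! Let g(r) = E√(r² + χ²), with χ² chi-squared with J degrees of freedom (`meanNorm`). Given B = b,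
the observed part bX is independent of the J unobserved coordinates, so g(‖bX‖) is the conditional
mean of ‖X‖ given bX, with mean square error n − E g(‖bX‖)². This number depends on b only through
its count of ones, so estimates are proved for a fixed mask and then averaged over B (`le_mmse`,
`integral_b_X`).

Vanishing noise. Once the noise is frozen, an estimator based on Y is an estimator based on bX, so n
− E g² is a lower bound at every σ ≠ 0. Conversely g is 1-Lipschitz, so the estimator g(‖Y‖), which
does not need to know b, differs from g(‖bX‖) by at most ‖N‖, whose L² norm is σ√n. The two bounds
squeeze the limit.

Closed form. By the tower property E g² = E[‖X‖ g(‖bX‖)] = E[‖x‖ √(‖bx‖² + ‖y‖²)] with y an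
independent standard Gaussian in dimension J. For v = (x, y) in dimension n + J and u = ‖(1 − b)x‖²
/ ‖v‖², the root is ‖v‖ √(1 − u). After expansion of √(1 − u), each moment E[‖x‖ ‖v‖ uᵏ] reduces to
Gamma functions, because the direction and the norm of a Gaussian vector are independent; this is
used in dimensions n + J and n (`integral_mul_norm_mul_pow`, `hasSum_meanNormSq`).

Infinite noise. A constant estimator gives Var ‖X‖ as an upper bound. For the lower bound, write σ =
s/c with s² + c² = 1 and rotate each observed pair (signal, normalized noise): the measurement
becomes a function of one Gaussian vector alone, while the input stays L²-close to the other,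
independent one (`sqrt_variance_sub_le`).

Large dimension. The error is at most Var ‖X‖ ≤ 2, whatever n is (`mmse_le_two`). -/

/-! ### Images and density of the standard Gaussian measure -/

section GaussianMaps

variable {E F : Type*} [NormedAddCommGroup E] [InnerProductSpace ℝ E] [FiniteDimensional ℝ E]
  [MeasurableSpace E] [BorelSpace E] [NormedAddCommGroup F] [InnerProductSpace ℝ F]
  [FiniteDimensional ℝ F] [MeasurableSpace F] [BorelSpace F]

/-- A linear map whose adjoint is isometric maps the standard Gaussian measure to the standard
Gaussian measure. -/
lemma stdGaussian_map_of_norm_adjoint (A : E →L[ℝ] F) (B : F → E)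
    (hAB : ∀ x t, inner ℝ (A x) t = inner ℝ x (B t)) (hB : ∀ t, ‖B t‖ = ‖t‖) :
    (stdGaussian E).map A = stdGaussian F := by
  apply Measure.ext_of_charFun
  ext t
  rw [charFun_apply, integral_map (by fun_prop) (by fun_prop)]
  simp_rw [hAB]
  rw [← charFun_apply, charFun_stdGaussian, charFun_stdGaussian, hB]

lemma stdGaussian_withLp_prod :
    stdGaussian (WithLp 2 (E × F)) =
      ((stdGaussian E).prod (stdGaussian F)).map (WithLp.toLp 2) := by
  apply Measure.ext_of_charFun
  ext t
  rw [charFun_prod, charFun_stdGaussian, charFun_stdGaussian, charFun_stdGaussian,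
    ← Complex.exp_add]
  congr 1
  have := WithLp.prod_norm_sq_eq_of_L2 t
  have h2 : ((‖t‖ : ℂ)) ^ 2 = (‖t.fst‖ : ℂ) ^ 2 + (‖t.snd‖ : ℂ) ^ 2 := by exact_mod_cast this
  rw [h2]
  simp only [WithLp.ofLp_fst, WithLp.ofLp_snd]
  ring

/-- A linear map on a product whose adjoint is isometric maps the product of standard Gaussian
measures to the standard Gaussian measure. -/
lemma stdGaussian_prod_map_of_norm_adjoint {G : Type*} [NormedAddCommGroup G]
    [InnerProductSpace ℝ G] [FiniteDimensional ℝ G] [MeasurableSpace G] [BorelSpace G]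
    (A : E × F →L[ℝ] G) (B : G → E) (C : G → F)
    (hABC : ∀ x y t, inner ℝ (A (x, y)) t = inner ℝ x (B t) + inner ℝ y (C t))
    (hBC : ∀ t, ‖B t‖ ^ 2 + ‖C t‖ ^ 2 = ‖t‖ ^ 2) :
    ((stdGaussian E).prod (stdGaussian F)).map A = stdGaussian G := by
  have h := stdGaussian_map_of_norm_adjoint
    (A.comp (WithLp.prodContinuousLinearEquiv 2 ℝ E F).toContinuousLinearMap)
    (fun t => WithLp.toLp 2 (B t, C t)) (fun x t => by
      simp only [ContinuousLinearMap.comp_apply, WithLp.prod_inner_apply]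
      exact hABC _ _ _) (fun t => by
      have := WithLp.prod_norm_sq_eq_of_L2 (WithLp.toLp 2 (B t, C t))
      rw [WithLp.toLp_fst, WithLp.toLp_snd, hBC] at this
      exact (sq_eq_sq₀ (norm_nonneg _) (norm_nonneg _)).1 this)
  rw [stdGaussian_withLp_prod, Measure.map_map (by fun_prop) (by fun_prop)] at h
  exact h

/-- Both sides have the same characteristic function. The density is what gives access to polar
coordinates. -/
lemma stdGaussian_eq_withDensity :
    stdGaussian E = (volume : Measure E).withDensity
      (fun x => ENNReal.ofReal (((2 * Real.pi) ^ ((Module.finrank ℝ E : ℝ) / 2))⁻¹ *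
        Real.exp (-(1 / 2) * ‖x‖ ^ 2))) := by
  have hint : Integrable (fun x : E => Real.exp (-(1 / 2) * ‖x‖ ^ 2)) := by
    -- A non-integrable function has integral 0 by convention, whereas the Gaussian formula gives a
    -- positive value.
    by_contra h
    have h1 := GaussianFourier.integral_rexp_neg_mul_sq_norm (V := E) (b := 1 / 2) (by norm_num)
    rw [integral_undef h] at h1
    have : 0 < (Real.pi / (1 / 2)) ^ ((Module.finrank ℝ E : ℝ) / 2) := by positivity
    exact this.ne h1
  set c : ℝ := ((2 * Real.pi) ^ ((Module.finrank ℝ E : ℝ) / 2))⁻¹ with hc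
  have hc0 : 0 < c := by positivity
  have : IsFiniteMeasure ((volume : Measure E).withDensity
      (fun x => ENNReal.ofReal (c * Real.exp (-(1 / 2) * ‖x‖ ^ 2)))) :=
    isFiniteMeasure_withDensity_ofReal (hint.const_mul c).2
  symm
  apply Measure.ext_of_charFun
  ext t
  rw [charFun_stdGaussian, charFun_apply,
    integral_withDensity_eq_integral_toReal_smul (by fun_prop) (by simp)]
  have h1 := GaussianFourier.integral_cexp_neg_mul_sq_norm_add (V := E) (b := 1 / 2)
    (by norm_num) Complex.I t
  have h2 : ∀ x : E, (ENNReal.ofReal (c * Real.exp (-(1 / 2) * ‖x‖ ^ 2))).toReal •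
      Complex.exp (inner ℝ x t * Complex.I) = (c : ℂ) *
      Complex.exp (-(1 / 2) * (‖x‖ : ℂ) ^ 2 + Complex.I * inner ℝ t x) := by
    intro x
    rw [ENNReal.toReal_ofReal (by positivity), Complex.exp_add, real_inner_comm, Complex.real_smul]
    push_cast
    rw [mul_comm Complex.I]
    ring
  simp_rw [h2]
  rw [integral_const_mul, h1, ← mul_assoc]
  have h3 : (c : ℂ) * (Real.pi / (1 / 2)) ^ ((Module.finrank ℝ E : ℂ) / 2) = 1 := by
    have : ((Real.pi : ℂ) / (1 / 2)) ^ ((Module.finrank ℝ E : ℂ) / 2)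
        = (((2 * Real.pi) ^ ((Module.finrank ℝ E : ℝ) / 2) : ℝ) : ℂ) := by
      rw [Complex.ofReal_cpow (by positivity)]
      push_cast
      congr 1
      ring
    rw [this, ← Complex.ofReal_mul, hc, inv_mul_cancel₀ (by positivity)]
    simp
  rw [h3, one_mul]
  congr 1
  rw [Complex.I_sq]
  ring

lemma integral_stdGaussian (f : E → ℝ) :
    ∫ x, f x ∂stdGaussian E = ((2 * Real.pi) ^ ((Module.finrank ℝ E : ℝ) / 2))⁻¹ *
      ∫ x, f x * Real.exp (-(1 / 2) * ‖x‖ ^ 2) := by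
  rw [stdGaussian_eq_withDensity,
    integral_withDensity_eq_integral_toReal_smul (by fun_prop) (by simp), ← integral_const_mul]
  congr 1 with x
  rw [ENNReal.toReal_ofReal (by positivity), smul_eq_mul]
  ring

end GaussianMaps

/-! ### Independence of direction and norm; moments of the norm -/

section Radial

variable {E : Type*} [NormedAddCommGroup E] [InnerProductSpace ℝ E] [FiniteDimensional ℝ E]
  [MeasurableSpace E] [BorelSpace E]

/-- Integration in polar coordinates of a product of an angular and a radial function. -/
lemma integral_angular_mul_radial [Nontrivial E] (h : E → ℝ) (ψ : ℝ → ℝ)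
    (hh : ∀ (r : ℝ) (x : E), 0 < r → h (r • x) = h x) :
    ∫ x : E, h x * ψ ‖x‖ = (∫ θ, h θ ∂(volume : Measure E).toSphere) *
      ∫ r, ψ r ∂Measure.volumeIoiPow (Module.finrank ℝ E - 1) := by
  have h1 : ∫ x : E, h x * ψ ‖x‖ = ∫ x : ({(0)}ᶜ : Set E), h x.1 * ψ ‖x.1‖
      ∂((volume : Measure E).comap (↑)) := by
    rw [integral_subtype_comap (measurableSet_singleton _).compl fun x => h x * ψ ‖x‖,
      restrict_compl_singleton]
  rw [h1, ← integral_prod_mul (fun θ : Metric.sphere (0 : E) 1 => h θ)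
    (fun r : Set.Ioi (0 : ℝ) => ψ r),
    ← (volume : Measure E).measurePreserving_homeomorphUnitSphereProd.integral_comp
      (Homeomorph.measurableEmbedding _)]
  refine integral_congr_ae (.of_forall fun x => ?_)
  have hx : (0 : ℝ) < ‖(x : E)‖⁻¹ := inv_pos.2 (norm_pos_iff.2 x.2)
  simp [hh _ _ hx]

/-- Under the standard Gaussian measure, the direction and the norm are independent. -/
lemma integral_stdGaussian_angular_mul_radial [Nontrivial E] (h : E → ℝ) (ψ : ℝ → ℝ)
    (hh : ∀ (r : ℝ) (x : E), 0 < r → h (r • x) = h x) :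
    ∫ x, h x * ψ ‖x‖ ∂stdGaussian E =
      (∫ x, h x ∂stdGaussian E) * ∫ x, ψ ‖x‖ ∂stdGaussian E := by
  have key : ∀ (h' : E → ℝ) (ψ' : ℝ → ℝ), (∀ (r : ℝ) (x : E), 0 < r → h' (r • x) = h' x) →
      ∫ x, h' x * ψ' ‖x‖ ∂stdGaussian E = (∫ θ, h' θ ∂(volume : Measure E).toSphere) *
      (((2 * Real.pi) ^ ((Module.finrank ℝ E : ℝ) / 2))⁻¹ *
      ∫ r, ψ' r * Real.exp (-(1 / 2) * r ^ 2)
        ∂Measure.volumeIoiPow (Module.finrank ℝ E - 1)) := by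
    intro h' ψ' hh'
    rw [integral_stdGaussian]
    simp_rw [mul_assoc]
    rw [integral_angular_mul_radial h' (fun r => ψ' r * Real.exp (-(1 / 2) * r ^ 2)) hh']
    ring
  -- Total mass 1: the angular and radial normalizations are inverse to each other, so neither has
  -- to be computed.
  have h1 := key (fun _ => 1) (fun _ => 1) (by simp)
  have h2 := key h (fun _ => 1) hh
  have h3 := key (fun _ => 1) ψ (by simp)
  simp only [mul_one, integral_const, probReal_univ, smul_eq_mul, one_mul] at h1 h2 h3
  rw [key h ψ hh, h2, h3]
  linear_combination (∫ θ, h θ ∂(volume : Measure E).toSphere) *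
    (((2 * Real.pi) ^ ((Module.finrank ℝ E : ℝ) / 2))⁻¹ *
      ∫ r, ψ r * Real.exp (-(1 / 2) * r ^ 2)
        ∂Measure.volumeIoiPow (Module.finrank ℝ E - 1)) * h1

/-- Polar coordinates leave a Gamma integral times a constant containing the volume of the unit
ball; the case s = 0, where the integral is 1, eliminates that constant. -/
lemma integral_norm_rpow_stdGaussian [Nontrivial E] {s : ℝ} (hs : 0 ≤ s) :
    ∫ x, ‖x‖ ^ s ∂stdGaussian E = 2 ^ (s / 2) *
      Real.Gamma (((Module.finrank ℝ E : ℝ) + s) / 2) /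
        Real.Gamma ((Module.finrank ℝ E : ℝ) / 2) := by
  have hd : 0 < (Module.finrank ℝ E : ℝ) := by exact_mod_cast Module.finrank_pos
  have hd1 : ((Module.finrank ℝ E - 1 : ℕ) : ℝ) = (Module.finrank ℝ E : ℝ) - 1 :=
    Nat.cast_pred Module.finrank_pos
  set d : ℝ := ((Module.finrank ℝ E : ℕ) : ℝ) with hdd
  have key : ∀ s : ℝ, 0 ≤ s → ∫ x, ‖x‖ ^ s ∂stdGaussian E =
      (((2 * Real.pi) ^ (d / 2))⁻¹ * (d * (volume : Measure E).real (Metric.ball 0 1))) *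
      ((1 / 2) ^ (-(d + s) / 2) * (1 / 2) * Real.Gamma ((d + s) / 2)) := by
    intro s hs
    rw [integral_stdGaussian, integral_fun_norm_addHaar (volume : Measure E)
      (fun r => r ^ s * Real.exp (-(1 / 2) * r ^ 2))]
    have := integral_rpow_mul_exp_neg_mul_rpow (p := 2) (q := d - 1 + s) (b := 1 / 2)
      (by norm_num) (by linarith) (by norm_num)
    rw [show d - 1 + s + 1 = d + s by ring] at this
    rw [← this, nsmul_eq_mul, smul_eq_mul, ← hdd, mul_assoc, mul_assoc]
    congr 3
    refine setIntegral_congr_fun measurableSet_Ioi fun r hr => ?_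
    have hr : 0 < r := hr
    simp only [smul_eq_mul]
    rw [← Real.rpow_natCast, hd1, Real.rpow_add hr]
    norm_cast
    ring
  have h0 := key 0 le_rfl
  simp only [Real.rpow_zero, integral_const, probReal_univ, smul_eq_mul, mul_one, add_zero] at h0
  have hG : Real.Gamma (d / 2) ≠ 0 := (Real.Gamma_pos_of_pos (by positivity)).ne'
  rw [key s hs, eq_div_iff hG]
  have h2 : ((1 : ℝ) / 2) ^ (-(d + s) / 2) = (1 / 2) ^ (-d / 2) * 2 ^ (s / 2) := by
    rw [show -(d + s) / 2 = -d / 2 + -(s / 2) by ring, Real.rpow_add (by norm_num),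
      Real.rpow_neg (by norm_num) (s / 2), Real.div_rpow (by norm_num) (by norm_num),
      Real.div_rpow (by norm_num) (by norm_num)]
    simp
  rw [h2]
  linear_combination -(2 ^ (s / 2) * Real.Gamma ((d + s) / 2)) * h0

end Radial

/-! ### L² estimates -/

section SquareIntegrable

variable {Ω : Type*} {m m0 : MeasurableSpace Ω} {μ : Measure Ω}

/-- The conditional expectation minimizes the mean square error. -/
lemma integral_sub_condExp_sq_le (hm : m ≤ m0) [IsProbabilityMeasure μ] {f h : Ω → ℝ}
    (hf : MemLp f 2 μ) (hh : MemLp h 2 μ) (hhm : StronglyMeasurable[m] h) :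
    ∫ ω, (f ω - (μ[f | m]) ω) ^ 2 ∂μ ≤ ∫ ω, (f ω - h ω) ^ 2 ∂μ := by
  have he : MemLp (μ[f | m]) 2 μ := hf.condExp one_le_two
  have hfe : MemLp (f - μ[f | m]) 2 μ := hf.sub he
  have heh : MemLp (μ[f | m] - h) 2 μ := he.sub hh
  have hint : Integrable ((f - μ[f | m]) * (μ[f | m] - h)) μ := hfe.integrable_mul heh
  -- Orthogonality: the second factor is `m`-measurable and the residual has zero conditional mean.
  have hcross : ∫ ω, ((f - μ[f | m]) * (μ[f | m] - h)) ω ∂μ = 0 := by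
    rw [← integral_condExp hm]
    have h1 := condExp_mul_of_stronglyMeasurable_right
      (stronglyMeasurable_condExp.sub hhm) hint (hfe.integrable one_le_two)
    have h2 : μ[f - μ[f | m] | m] =ᵐ[μ] 0 := by
      refine (condExp_sub (hf.integrable one_le_two) integrable_condExp m).trans ?_
      rw [condExp_of_stronglyMeasurable hm stronglyMeasurable_condExp integrable_condExp, sub_self]
    rw [integral_congr_ae (h1.trans (h2.mul (ae_eq_refl _)))]
    simp
  have hsum : ∫ ω, (f ω - h ω) ^ 2 ∂μ = ∫ ω, (f ω - (μ[f | m]) ω) ^ 2 ∂μ +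
      (2 * ∫ ω, ((f - μ[f | m]) * (μ[f | m] - h)) ω ∂μ +
        ∫ ω, ((μ[f | m]) ω - h ω) ^ 2 ∂μ) := by
    have h1 : Integrable (fun ω => (f ω - (μ[f | m]) ω) ^ 2) μ := hfe.integrable_sq
    have h2 : Integrable (fun ω => 2 * ((f - μ[f | m]) * (μ[f | m] - h)) ω) μ := hint.const_mul 2
    have h3 : Integrable (fun ω => ((μ[f | m]) ω - h ω) ^ 2) μ := heh.integrable_sq
    have h23 : Integrable (fun ω => 2 * ((f - μ[f | m]) * (μ[f | m] - h)) ω +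
      ((μ[f | m]) ω - h ω) ^ 2) μ := h2.add h3
    rw [← integral_const_mul, ← integral_add h2 h3, ← integral_add h1 h23]
    refine integral_congr_ae (.of_forall fun ω => ?_)
    simp only [Pi.mul_apply, Pi.sub_apply]
    ring
  rw [hsum, hcross]
  have : 0 ≤ ∫ ω, ((μ[f | m]) ω - h ω) ^ 2 ∂μ := integral_nonneg fun _ => sq_nonneg _
  linarith

lemma sqrt_integral_sq_eq_eLpNorm {f : Ω → ℝ} (hf : MemLp f 2 μ) :
    √(∫ ω, f ω ^ 2 ∂μ) = (eLpNorm f 2 μ).toReal := by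
  rw [hf.eLpNorm_eq_integral_rpow_norm (by norm_num) (by norm_num),
    ENNReal.toReal_ofReal (by positivity), Real.sqrt_eq_rpow]
  norm_num

/-- Minkowski's inequality for a function dominated by a sum. -/
lemma sqrt_integral_sq_le_add {f g k : Ω → ℝ} (hf : MemLp f 2 μ) (hg : MemLp g 2 μ)
    (hk : AEStronglyMeasurable k μ) (h : ∀ ω, |k ω| ≤ |f ω| + |g ω|) :
    √(∫ ω, k ω ^ 2 ∂μ) ≤ √(∫ ω, f ω ^ 2 ∂μ) + √(∫ ω, g ω ^ 2 ∂μ) := by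
  have hle : ∀ ω, ‖k ω‖ ≤ ‖|f ω| + |g ω|‖ := fun ω => by
    rw [Real.norm_eq_abs, Real.norm_of_nonneg (by positivity)]
    exact h ω
  have hfa : MemLp (fun ω => |f ω|) 2 μ := hf.abs
  have hga : MemLp (fun ω => |g ω|) 2 μ := hg.abs
  have hk2 : MemLp k 2 μ := (hfa.add hga).mono hk (.of_forall hle)
  have hab : ∀ f : Ω → ℝ, ∫ ω, f ω ^ 2 ∂μ = ∫ ω, |f ω| ^ 2 ∂μ := fun f => by simp [sq_abs]
  rw [hab f, hab g, sqrt_integral_sq_eq_eLpNorm hk2, sqrt_integral_sq_eq_eLpNorm hfa,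
    sqrt_integral_sq_eq_eLpNorm hga, ← ENNReal.toReal_add hfa.2.ne hga.2.ne]
  refine ENNReal.toReal_mono (ENNReal.add_lt_top.2 ⟨hfa.2, hga.2⟩).ne ?_
  exact (eLpNorm_mono hle).trans (eLpNorm_add_le hfa.1 hga.1 one_le_two)

lemma integral_sub_const_sq [IsProbabilityMeasure μ] {f : Ω → ℝ} (hf : MemLp f 2 μ) (c : ℝ) :
    ∫ ω, (f ω - c) ^ 2 ∂μ =
      ∫ ω, f ω ^ 2 ∂μ - (∫ ω, f ω ∂μ) ^ 2 + (∫ ω, f ω ∂μ - c) ^ 2 := by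
  have h1 : Integrable f μ := hf.integrable one_le_two
  have : ∀ ω, (f ω - c) ^ 2 = f ω ^ 2 - ((2 * c) * f ω - c ^ 2) := fun ω => by ring
  simp_rw [this]
  have h2 : Integrable (fun ω => 2 * c * f ω) μ := h1.const_mul _
  have h3 : Integrable (fun ω => 2 * c * f ω - c ^ 2) μ := h2.sub (integrable_const _)
  rw [integral_sub hf.integrable_sq h3, integral_sub h2 (integrable_const _), integral_const_mul]
  simp
  ring

end SquareIntegrable

/-! ### Coordinate projections of Gaussian vectors -/

section Mask

variable {ι : Type*} [Fintype ι] [DecidableEq ι]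

/-- Multiplication of the coordinates of a vector by those of `b`. -/
noncomputable def mask (b : ι → ℝ) : EuclideanSpace ℝ ι →L[ℝ] EuclideanSpace ℝ ι :=
  (Matrix.toEuclideanLin (Matrix.diagonal b)).toContinuousLinearMap

@[simp]
lemma mask_apply (b : ι → ℝ) (x : EuclideanSpace ℝ ι) (i : ι) : mask b x i = b i * x i := by
  simp [mask, Matrix.toLpLin_apply, Matrix.mulVec_diagonal]

lemma measurable_mask {α : Type*} [MeasurableSpace α] {f : α → ι → ℝ}
    {g : α → EuclideanSpace ℝ ι} (hf : Measurable f) (hg : Measurable g) :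
    Measurable fun a => mask (f a) (g a) := by
  have : (fun a => mask (f a) (g a)) = fun a => WithLp.toLp 2 fun i => f a i * g a i := by
    ext a i
    simp
  rw [this]
  fun_prop

lemma inner_mask (b : ι → ℝ) (x t : EuclideanSpace ℝ ι) :
    inner ℝ (mask b x) t = inner ℝ x (mask b t) := by
  simp only [PiLp.inner_apply, mask_apply]
  congr 1 with i
  simp
  ring

lemma mask_mask_add_mask_compl {b : ι → ℝ} (hb : ∀ i, b i = 0 ∨ b i = 1)
    (x y : EuclideanSpace ℝ ι) : mask b (mask b x + mask (1 - b) y) = mask b x := by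
  ext i
  rcases hb i with h | h <;> simp [h]

lemma norm_mask_add_sq {b : ι → ℝ} (hb : ∀ i, b i = 0 ∨ b i = 1) (x y : EuclideanSpace ℝ ι) :
    ‖mask b x + mask (1 - b) y‖ ^ 2 = ‖mask b x‖ ^ 2 + ‖mask (1 - b) y‖ ^ 2 := by
  simp only [EuclideanSpace.real_norm_sq_eq, ← Finset.sum_add_distrib]
  refine Finset.sum_congr rfl fun i _ => ?_
  rcases hb i with h | h <;> simp [h]

lemma mask_add_mask_compl (b : ι → ℝ) (x : EuclideanSpace ℝ ι) :
    mask b x + mask (1 - b) x = x := by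
  ext i
  simp
  ring

lemma norm_sq_eq_mask_add {b : ι → ℝ} (hb : ∀ i, b i = 0 ∨ b i = 1) (x : EuclideanSpace ℝ ι) :
    ‖x‖ ^ 2 = ‖mask b x‖ ^ 2 + ‖mask (1 - b) x‖ ^ 2 := by
  rw [← norm_mask_add_sq hb, mask_add_mask_compl]

lemma norm_mask_le {b : ι → ℝ} (hb : ∀ i, b i = 0 ∨ b i = 1) (x : EuclideanSpace ℝ ι) :
    ‖mask b x‖ ≤ ‖x‖ := by
  have := norm_sq_eq_mask_add hb x
  exact le_of_sq_le_sq (by nlinarith [sq_nonneg ‖mask (1 - b) x‖]) (norm_nonneg _)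

/-- The unobserved coordinates may be resampled from an independent copy. Conditioning on the
observed ones thus becomes integration over the second variable. -/
lemma measurePreserving_mask_add {b : ι → ℝ} (hb : ∀ i, b i = 0 ∨ b i = 1) :
    MeasurePreserving (fun p : EuclideanSpace ℝ ι × EuclideanSpace ℝ ι =>
      mask b p.1 + mask (1 - b) p.2)
      ((stdGaussian (EuclideanSpace ℝ ι)).prod (stdGaussian (EuclideanSpace ℝ ι)))
      (stdGaussian (EuclideanSpace ℝ ι)) := by
  refine ⟨by fun_prop, ?_⟩
  exact stdGaussian_prod_map_of_norm_adjoint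
    ((mask b).comp (.fst ℝ _ _) + (mask (1 - b)).comp (.snd ℝ _ _)) (mask b) (mask (1 - b))
    (fun x y t => by simp [inner_add_left, inner_mask])
    (fun t => (norm_sq_eq_mask_add hb t).symm)

/-- The standard Gaussian measure is invariant under a rotation of the pairs of coordinates
selected by `b`. -/
lemma measurePreserving_mask_rotation {b : ι → ℝ} (hb : ∀ i, b i = 0 ∨ b i = 1) {s c : ℝ}
    (hsc : s ^ 2 + c ^ 2 = 1) :
    MeasurePreserving (fun p : EuclideanSpace ℝ ι × EuclideanSpace ℝ ι =>
      (mask b (s • p.1 + c • p.2) + mask (1 - b) p.1,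
        mask b (s • p.2 - c • p.1) + mask (1 - b) p.2))
      ((stdGaussian (EuclideanSpace ℝ ι)).prod (stdGaussian (EuclideanSpace ℝ ι)))
      ((stdGaussian (EuclideanSpace ℝ ι)).prod (stdGaussian (EuclideanSpace ℝ ι))) := by
  refine ⟨by fun_prop, ?_⟩
  let π₁ := ContinuousLinearMap.fst ℝ (EuclideanSpace ℝ ι) (EuclideanSpace ℝ ι)
  let π₂ := ContinuousLinearMap.snd ℝ (EuclideanSpace ℝ ι) (EuclideanSpace ℝ ι)
  -- The target carries the L² norm, since the criterion by adjoints needs an inner product there;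
  -- the transport back to the plain product is at the end.
  let A : EuclideanSpace ℝ ι × EuclideanSpace ℝ ι →L[ℝ]
      WithLp 2 (EuclideanSpace ℝ ι × EuclideanSpace ℝ ι) :=
    (WithLp.prodContinuousLinearEquiv 2 ℝ _ _).symm.toContinuousLinearMap.comp
      (((mask b).comp (s • π₁ + c • π₂) + (mask (1 - b)).comp π₁).prod
      ((mask b).comp (s • π₂ - c • π₁) + (mask (1 - b)).comp π₂))
  have hA := stdGaussian_prod_map_of_norm_adjoint A
    (fun t => mask b (s • t.fst - c • t.snd) + mask (1 - b) t.fst)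
    (fun t => mask b (c • t.fst + s • t.snd) + mask (1 - b) t.snd)
    (fun x y t => by
      simp only [A, WithLp.prod_inner_apply]
      simp [π₁, π₂, inner_add_left, inner_sub_left, inner_add_right, inner_sub_right, inner_smul_left,
        inner_smul_right, inner_mask]
      ring)
    (fun t => by
      rw [WithLp.prod_norm_sq_eq_of_L2]
      simp only [EuclideanSpace.real_norm_sq_eq, ← Finset.sum_add_distrib]
      refine Finset.sum_congr rfl fun i _ => ?_
      rcases hb i with h | h
      · simp [h]
      · simp [h]
        linear_combination (t.fst i ^ 2 + t.snd i ^ 2) * hsc)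
  rw [stdGaussian_withLp_prod] at hA
  have h2 := congrArg (fun μ => Measure.map (WithLp.ofLp) μ) hA
  simp only at h2
  rw [Measure.map_map (by fun_prop) (by fun_prop), Measure.map_map (by fun_prop) (by fun_prop)]
    at h2
  have h3 : (WithLp.ofLp ∘ WithLp.toLp 2 : EuclideanSpace ℝ ι × EuclideanSpace ℝ ι → _) = id := rfl
  rw [h3, Measure.map_id] at h2
  exact h2

/-- The law of the norm of the projection of a standard Gaussian vector to `m` coordinates. -/
lemma map_norm_mask_stdGaussian {b : ι → ℝ} (hb : ∀ i, b i = 0 ∨ b i = 1) {m : ℕ}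
    (hm : ∑ i, b i = m) :
    (stdGaussian (EuclideanSpace ℝ ι)).map (fun x => ‖mask b x‖) =
      (stdGaussian (EuclideanSpace ℝ (Fin m))).map (fun x => ‖x‖) := by
  have hsum : ∀ φ : ι → ℝ, ∑ i, b i * φ i = ∑ i ∈ Finset.univ.filter (fun i => b i = 1), φ i := by
    intro φ
    rw [Finset.sum_filter]
    refine Finset.sum_congr rfl fun i _ => ?_
    rcases hb i with h | h <;> simp [h]
  have hcard : (Finset.univ.filter (fun i => b i = 1)).card = m := by
    have := hsum 1
    simp only [Pi.one_apply, mul_one, Finset.sum_const, nsmul_eq_mul, hm] at this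
    exact_mod_cast this.symm
  let e : Fin m ≃ {i // i ∈ Finset.univ.filter (fun i => b i = 1)} :=
    (Finset.equivFinOfCardEq hcard).symm
  have hsum' : ∀ φ : ι → ℝ, ∑ i, b i * φ i = ∑ j, φ (e j) := by
    intro φ
    rw [hsum, ← Finset.sum_coe_sort]
    exact (e.sum_comp fun i => φ i).symm
  have hsq : ∀ i, b i ^ 2 = b i := fun i => by rcases hb i with h | h <;> simp [h]
  let A : EuclideanSpace ℝ ι →L[ℝ] EuclideanSpace ℝ (Fin m) :=
    (PiLp.continuousLinearEquiv 2 ℝ (fun _ : Fin m => ℝ)).symm.toContinuousLinearMap.comp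
      (ContinuousLinearMap.pi fun j => EuclideanSpace.proj (e j : ι))
  have hAx : ∀ x j, A x j = x (e j) := fun x j => rfl
  -- Extension by zero, the adjoint of `A`. The factor `b i` placed in front of it below changes
  -- nothing, but puts the sums in the form of `hsum'`.
  let t' : EuclideanSpace ℝ (Fin m) → ι → ℝ := fun t i => ∑ j, if (e j : ι) = i then t j else 0
  have ht' : ∀ t j, t' t (e j) = t j := fun t j => by
    simp [t', e.injective.eq_iff]
  have hA := stdGaussian_map_of_norm_adjoint A (fun t => WithLp.toLp 2 fun i => b i * t' t i)
    (fun x t => by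
      simp only [PiLp.inner_apply, hAx, RCLike.inner_apply, conj_trivial]
      simp_rw [mul_assoc]
      rw [hsum']
      simp [ht'])
    (fun t => by
      rw [← sq_eq_sq₀ (norm_nonneg _) (norm_nonneg _), EuclideanSpace.real_norm_sq_eq,
        EuclideanSpace.real_norm_sq_eq]
      simp_rw [mul_pow, hsq]
      rw [hsum']
      simp [ht'])
  rw [← hA, Measure.map_map (by fun_prop) (by fun_prop)]
  congr 1
  ext x
  rw [Function.comp_apply, ← sq_eq_sq₀ (norm_nonneg _) (norm_nonneg _),
    EuclideanSpace.real_norm_sq_eq, EuclideanSpace.real_norm_sq_eq]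
  simp_rw [mask_apply, mul_pow, hsq, hAx]
  rw [hsum']

end Mask

/-! ### Integer moments of the norm; normalization of the noise -/

section GaussianNorm

variable {E : Type*} [NormedAddCommGroup E] [InnerProductSpace ℝ E] [FiniteDimensional ℝ E]
  [MeasurableSpace E] [BorelSpace E]

lemma memLp_norm_stdGaussian (p : ENNReal) (hp : p ≠ ⊤) :
    MemLp (fun x : E => ‖x‖) p (stdGaussian E) :=
  (IsGaussian.memLp_id (stdGaussian E) p hp).norm

lemma integral_norm_pow_stdGaussian [Nontrivial E] (k : ℕ) :
    ∫ x, ‖x‖ ^ k ∂stdGaussian E = 2 ^ ((k : ℝ) / 2) *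
      Real.Gamma (((Module.finrank ℝ E : ℝ) + k) / 2) /
        Real.Gamma ((Module.finrank ℝ E : ℝ) / 2) := by
  rw [← integral_norm_rpow_stdGaussian (E := E) k.cast_nonneg]
  simp

lemma integral_norm_sq_stdGaussian [Nontrivial E] :
    ∫ x, ‖x‖ ^ 2 ∂stdGaussian E = Module.finrank ℝ E := by
  have hd : 0 < (Module.finrank ℝ E : ℝ) := by exact_mod_cast Module.finrank_pos
  rw [integral_norm_pow_stdGaussian]
  have h : Real.Gamma (((Module.finrank ℝ E : ℝ) + (2 : ℕ)) / 2) =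
      (Module.finrank ℝ E : ℝ) / 2 * Real.Gamma ((Module.finrank ℝ E : ℝ) / 2) := by
    rw [← Real.Gamma_add_one (by positivity)]
    congr 1
    push_cast
    ring
  have hG : Real.Gamma ((Module.finrank ℝ E : ℝ) / 2) ≠ 0 :=
    (Real.Gamma_pos_of_pos (by positivity)).ne'
  rw [h]
  field_simp
  norm_num

end GaussianNorm

lemma map_inv_smul_multivariateGaussian {ι : Type*} [Fintype ι] [DecidableEq ι] {σ : ℝ}
    (hσ : σ ≠ 0) :
    (multivariateGaussian (0 : EuclideanSpace ℝ ι) (σ ^ 2 • (1 : Matrix ι ι ℝ))).map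
      (fun x => σ⁻¹ • x) = stdGaussian (EuclideanSpace ℝ ι) := by
  apply Measure.ext_of_charFun
  ext t
  have hS : (σ ^ 2 • (1 : Matrix ι ι ℝ)).PosSemidef := Matrix.PosSemidef.one.smul (sq_nonneg σ)
  rw [charFun_map_smul, charFun_multivariateGaussian hS, charFun_stdGaussian]
  congr 1
  have : ‖t‖ ^ 2 = t.ofLp ⬝ᵥ t.ofLp := by
    rw [EuclideanSpace.real_norm_sq_eq]
    simp [dotProduct, sq]
  rw [← Complex.ofReal_pow, this]
  have hσ' : (σ : ℂ) ≠ 0 := by exact_mod_cast hσ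
  simp [Matrix.smul_mulVec]
  field_simp

/-! ### Reduction of the model to a fixed mask and Gaussian integrals -/

namespace MeasurementModel

variable {n K : ℕ} {σ : ℝ} (M : MeasurementModel.{u} n K σ)

lemma Y_eq (ω : M.Ω) : M.Y ω = mask (M.b ω) (M.X ω) + M.N ω := rfl

lemma measurable_Y : Measurable M.Y := by
  have h : Measurable fun ω => mask (M.b ω) (M.X ω) :=
    measurable_mask M.measurable_b M.measurable_X
  have hY : M.Y = fun ω => mask (M.b ω) (M.X ω) + M.N ω := funext M.Y_eq
  rw [hY]
  exact h.add M.measurable_N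

lemma measurable_inv_smul_N : Measurable fun ω => σ⁻¹ • M.N ω :=
  (measurable_const_smul σ⁻¹).comp M.measurable_N

lemma map_X : M.P.map M.X = stdGaussian (EuclideanSpace ℝ (Fin n)) := by
  rw [M.law_X, multivariateGaussian_zero_one]

lemma map_inv_smul_N (hσ : σ ≠ 0) :
    M.P.map (fun ω => σ⁻¹ • M.N ω) = stdGaussian (EuclideanSpace ℝ (Fin n)) := by
  rw [← map_inv_smul_multivariateGaussian hσ, ← M.law_N,
    Measure.map_map (by fun_prop) M.measurable_N]
  rfl

lemma memLp_norm_X : MemLp (fun ω => ‖M.X ω‖) 2 M.P := by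
  have h := memLp_norm_stdGaussian (E := EuclideanSpace ℝ (Fin n)) 2 (by norm_num)
  rw [← M.map_X] at h
  exact h.comp_of_map M.measurable_X.aemeasurable

lemma memLp_norm_N (hσ : σ ≠ 0) : MemLp (fun ω => ‖M.N ω‖) 2 M.P := by
  have h := memLp_norm_stdGaussian (E := EuclideanSpace ℝ (Fin n)) 2 (by norm_num)
  rw [← M.map_inv_smul_N hσ] at h
  have h2 := (h.comp_of_map M.measurable_inv_smul_N.aemeasurable).const_mul |σ|
  refine h2.congr_norm M.measurable_N.norm.aestronglyMeasurable (.of_forall fun ω => ?_)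
  simp [norm_smul, hσ]

lemma map_b_X_N (hσ : σ ≠ 0) :
    M.P.map (fun ω => (M.b ω, (M.X ω, σ⁻¹ • M.N ω))) =
      (M.P.map M.b).prod ((stdGaussian (EuclideanSpace ℝ (Fin n))).prod
        (stdGaussian (EuclideanSpace ℝ (Fin n)))) := by
  have hN := M.measurable_inv_smul_N
  have h1 : IndepFun M.b (fun ω => (M.X ω, σ⁻¹ • M.N ω)) M.P :=
    M.indep_b_XN.comp (φ := id) (ψ := Prod.map id (fun x => σ⁻¹ • x)) measurable_id (by fun_prop)
  have h2 : IndepFun M.X (fun ω => σ⁻¹ • M.N ω) M.P :=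
    M.indep_X_N.comp (φ := id) (ψ := fun p => σ⁻¹ • p) measurable_id (by fun_prop)
  rw [(indepFun_iff_map_prod_eq_prod_map_map M.measurable_b.aemeasurable
      (M.measurable_X.prodMk hN).aemeasurable).1 h1,
    (indepFun_iff_map_prod_eq_prod_map_map M.measurable_X.aemeasurable hN.aemeasurable).1 h2,
    M.map_X, M.map_inv_smul_N hσ]

lemma ae_map_b :
    ∀ᵐ b : Fin n → ℝ ∂M.P.map M.b, (∀ i, b i = 0 ∨ b i = 1) ∧ ∑ i, b i = (K : ℝ) := by
  have hmeas : MeasurableSet {b : Fin n → ℝ | (∀ i, b i = 0 ∨ b i = 1) ∧ ∑ i, b i = (K : ℝ)} := by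
    measurability
  rw [ae_map_iff M.measurable_b.aemeasurable hmeas]
  exact .of_forall fun ω => ⟨M.b_zero_or_one ω, M.sum_b ω⟩

/-- The mean square error is at most that of any other estimator. -/
lemma mmse_le {h : EuclideanSpace ℝ (Fin n) → ℝ} (hh : Measurable h)
    (hL : MemLp (fun ω => h (M.Y ω)) 2 M.P) :
    M.mmse ≤ ∫ ω, (‖M.X ω‖ - h (M.Y ω)) ^ 2 ∂M.P :=
  integral_sub_condExp_sq_le M.measurable_Y.comap_le M.memLp_norm_X hL
    (hh.comp (comap_measurable M.Y)).stronglyMeasurable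

/-- A lower bound for the mean square error that holds for each value of the matrix `B`. -/
lemma le_mmse (hσ : σ ≠ 0) {c : ℝ}
    (h : ∀ b : Fin n → ℝ, (∀ i, b i = 0 ∨ b i = 1) → ∑ i, b i = K →
      ∀ v : EuclideanSpace ℝ (Fin n) → ℝ, Measurable v →
      Integrable (fun p : EuclideanSpace ℝ (Fin n) × EuclideanSpace ℝ (Fin n) =>
        (‖p.1‖ - v (mask b p.1 + σ • p.2)) ^ 2)
        ((stdGaussian (EuclideanSpace ℝ (Fin n))).prod
          (stdGaussian (EuclideanSpace ℝ (Fin n)))) →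
      c ≤ ∫ p, (‖p.1‖ - v (mask b p.1 + σ • p.2)) ^ 2
        ∂((stdGaussian (EuclideanSpace ℝ (Fin n))).prod
          (stdGaussian (EuclideanSpace ℝ (Fin n))))) :
    c ≤ M.mmse := by
  have hN := M.measurable_inv_smul_N
  -- The conditional expectation is measurable for the σ-algebra of `Y`, hence factors through `Y`
  -- (Doob–Dynkin). The same `v` then serves for every value of `b`.
  obtain ⟨v, hv, hve⟩ : ∃ v : EuclideanSpace ℝ (Fin n) → ℝ, Measurable v ∧
      M.estimator = v ∘ M.Y := by
    obtain ⟨v, hv, hve⟩ := (stronglyMeasurable_condExp (m := MeasurableSpace.comap M.Y inferInstance)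
      (f := fun ω => ‖M.X ω‖) (μ := M.P)).measurable.exists_eq_measurable_comp
    exact ⟨v, hv, hve⟩
  set F : (Fin n → ℝ) × (EuclideanSpace ℝ (Fin n) × EuclideanSpace ℝ (Fin n)) → ℝ :=
    fun q => (‖q.2.1‖ - v (mask q.1 q.2.1 + σ • q.2.2)) ^ 2 with hF
  have hFm : Measurable F := by
    have h1 : Measurable fun q : (Fin n → ℝ) ×
        (EuclideanSpace ℝ (Fin n) × EuclideanSpace ℝ (Fin n)) => mask q.1 q.2.1 :=
      measurable_mask measurable_fst measurable_snd.fst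
    have h2 : Measurable fun q : (Fin n → ℝ) ×
        (EuclideanSpace ℝ (Fin n) × EuclideanSpace ℝ (Fin n)) =>
        v (mask q.1 q.2.1 + σ • q.2.2) := hv.comp (h1.add (by fun_prop))
    exact (Measurable.sub (by fun_prop) h2).pow_const 2
  have hT : Measurable fun ω => (M.b ω, (M.X ω, σ⁻¹ • M.N ω)) :=
    M.measurable_b.prodMk (M.measurable_X.prodMk hN)
  have hcomp : ∀ ω, F (M.b ω, (M.X ω, σ⁻¹ • M.N ω)) = (‖M.X ω‖ - M.estimator ω) ^ 2 := by
    intro ω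
    simp [hF, hve, Y_eq, smul_smul, hσ]
  have hint : Integrable (fun ω => (‖M.X ω‖ - M.estimator ω) ^ 2) M.P :=
    (M.memLp_norm_X.sub (M.memLp_norm_X.condExp one_le_two)).integrable_sq
  have hint' : Integrable F (M.P.map fun ω => (M.b ω, (M.X ω, σ⁻¹ • M.N ω))) := by
    rw [integrable_map_measure hFm.aestronglyMeasurable hT.aemeasurable]
    exact hint.congr (.of_forall fun ω => (hcomp ω).symm)
  have hmmse : M.mmse = ∫ q, F q ∂(M.P.map fun ω => (M.b ω, (M.X ω, σ⁻¹ • M.N ω))) := by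
    rw [integral_map hT.aemeasurable hFm.aestronglyMeasurable]
    exact integral_congr_ae (.of_forall fun ω => (hcomp ω).symm)
  rw [M.map_b_X_N hσ] at hint' hmmse
  have := Measure.isProbabilityMeasure_map (μ := M.P) M.measurable_b.aemeasurable
  rw [hmmse, integral_prod _ hint']
  calc c = ∫ _, c ∂(M.P.map M.b) := by simp
    _ ≤ _ := by
      refine integral_mono_ae (integrable_const _) hint'.integral_prod_left ?_
      filter_upwards [M.ae_map_b, hint'.prod_right_ae] with b hb hi
      exact h b hb.1 hb.2 v hv hi

/-- The mean of a function of `B` and `X` whose mean is the same for each value of `B`. -/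
lemma integral_b_X {F : (Fin n → ℝ) × EuclideanSpace ℝ (Fin n) → ℝ} (hF : Measurable F)
    (hint : Integrable (fun ω => F (M.b ω, M.X ω)) M.P) {c : ℝ}
    (h : ∀ b : Fin n → ℝ, (∀ i, b i = 0 ∨ b i = 1) → ∑ i, b i = K →
      ∫ x, F (b, x) ∂stdGaussian (EuclideanSpace ℝ (Fin n)) = c) :
    ∫ ω, F (M.b ω, M.X ω) ∂M.P = c := by
  have hT : Measurable fun ω => (M.b ω, M.X ω) := M.measurable_b.prodMk M.measurable_X
  have h1 : IndepFun M.b M.X M.P :=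
    M.indep_b_XN.comp (φ := id) (ψ := Prod.fst) measurable_id measurable_fst
  have hlaw := (indepFun_iff_map_prod_eq_prod_map_map M.measurable_b.aemeasurable
      M.measurable_X.aemeasurable).1 h1
  rw [M.map_X] at hlaw
  have hint' : Integrable F (M.P.map fun ω => (M.b ω, M.X ω)) := by
    rwa [integrable_map_measure hF.aestronglyMeasurable hT.aemeasurable]
  have hmap := integral_map hT.aemeasurable (μ := M.P) hF.aestronglyMeasurable
  rw [hlaw] at hint' hmap
  have := Measure.isProbabilityMeasure_map (μ := M.P) M.measurable_b.aemeasurable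
  rw [← hmap, integral_prod _ hint']
  calc _ = ∫ _, c ∂(M.P.map M.b) := by
        refine integral_congr_ae ?_
        filter_upwards [M.ae_map_b] with b hb
        exact h b hb.1 hb.2
    _ = c := by simp

end MeasurementModel

/-! ### The noiseless optimal estimator -/

section MeanNorm

/-- The mean of `√(r² + χ²)`, where `χ²` is a chi-squared variable with `J` degrees of freedom. -/
noncomputable def meanNorm (J : ℕ) (r : ℝ) : ℝ :=
  ∫ y, √(r ^ 2 + ‖y‖ ^ 2) ∂stdGaussian (EuclideanSpace ℝ (Fin J))

/-- The second moment of `meanNorm J ‖x‖` for a standard Gaussian vector `x` in dimension `K`. -/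
noncomputable def meanNormSq (K J : ℕ) : ℝ :=
  ∫ x, meanNorm J ‖x‖ ^ 2 ∂stdGaussian (EuclideanSpace ℝ (Fin K))

/-- Triangle inequality in the plane for the points (r, a) and (s, a). Averaged over `a`, it makes
`meanNorm` 1-Lipschitz, which controls the effect of small noise. -/
lemma abs_sqrt_add_sq_sub_le (r s a : ℝ) :
    |√(r ^ 2 + a ^ 2) - √(s ^ 2 + a ^ 2)| ≤ |r - s| := by
  have key : ∀ r s : ℝ, √(r ^ 2 + a ^ 2) ≤ √(s ^ 2 + a ^ 2) + |r - s| := by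
    intro r s
    have h1 := Real.sq_sqrt (show 0 ≤ s ^ 2 + a ^ 2 by positivity)
    have h2 : |s| ≤ √(s ^ 2 + a ^ 2) := Real.abs_le_sqrt (by nlinarith [sq_nonneg a])
    have h3 : s * (r - s) ≤ |s| * |r - s| := by
      rw [← abs_mul]
      exact le_abs_self _
    have h4 : |s| * |r - s| ≤ √(s ^ 2 + a ^ 2) * |r - s| := by gcongr
    refine Real.sqrt_le_iff.2 ⟨by positivity, ?_⟩
    nlinarith [sq_abs (r - s)]
  rw [abs_sub_le_iff]
  exact ⟨by linarith [key r s], by linarith [key s r, abs_sub_comm r s]⟩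

lemma memLp_sqrt_add_sq {Ω : Type*} [MeasurableSpace Ω] {μ : Measure Ω} [IsFiniteMeasure μ]
    {f : Ω → ℝ} (hf : MemLp f 2 μ) (r : ℝ) : MemLp (fun ω => √(r ^ 2 + f ω ^ 2)) 2 μ := by
  have h2 : MemLp (fun ω => |r| + |f ω|) 2 μ := (memLp_const |r|).add hf.abs
  have hc : Continuous fun t : ℝ => √(r ^ 2 + t ^ 2) := by fun_prop
  refine h2.mono (hc.comp_aestronglyMeasurable hf.1) (.of_forall fun ω => ?_)
  rw [Real.norm_of_nonneg (by positivity), Real.norm_of_nonneg (by positivity)]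
  refine Real.sqrt_le_iff.2 ⟨by positivity, ?_⟩
  nlinarith [mul_nonneg (abs_nonneg r) (abs_nonneg (f ω)), sq_abs r, sq_abs (f ω)]

lemma memLp_sqrt_add_norm_sq_stdGaussian (J : ℕ) (r : ℝ) :
    MemLp (fun y : EuclideanSpace ℝ (Fin J) => √(r ^ 2 + ‖y‖ ^ 2)) 2
      (stdGaussian (EuclideanSpace ℝ (Fin J))) :=
  memLp_sqrt_add_sq (memLp_norm_stdGaussian 2 (by norm_num)) r

lemma abs_meanNorm_sub_le (J : ℕ) (r s : ℝ) : |meanNorm J r - meanNorm J s| ≤ |r - s| := by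
  have hr := (memLp_sqrt_add_norm_sq_stdGaussian J r).integrable one_le_two
  have hs := (memLp_sqrt_add_norm_sq_stdGaussian J s).integrable one_le_two
  rw [meanNorm, meanNorm, ← integral_sub hr hs]
  refine (abs_integral_le_integral_abs).trans ?_
  calc _ ≤ ∫ _, |r - s| ∂stdGaussian (EuclideanSpace ℝ (Fin J)) :=
        integral_mono (hr.sub hs).abs (integrable_const _) fun y => abs_sqrt_add_sq_sub_le r s ‖y‖
    _ = |r - s| := by simp

lemma continuous_meanNorm (J : ℕ) : Continuous (meanNorm J) := by
  refine (LipschitzWith.of_dist_le_mul (K := 1) fun r s => ?_).continuous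
  simpa [Real.dist_eq] using abs_meanNorm_sub_le J r s

lemma memLp_meanNorm {Ω : Type*} [MeasurableSpace Ω] {μ : Measure Ω} [IsFiniteMeasure μ] (J : ℕ)
    {f : Ω → ℝ} (hf : MemLp f 2 μ) : MemLp (fun ω => meanNorm J (f ω)) 2 μ := by
  have h2 : MemLp (fun ω => |f ω| + |meanNorm J 0|) 2 μ := hf.abs.add (memLp_const _)
  refine h2.mono ((continuous_meanNorm J).comp_aestronglyMeasurable hf.1) (.of_forall fun ω => ?_)
  rw [Real.norm_eq_abs, Real.norm_of_nonneg (by positivity)]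
  have h3 := abs_meanNorm_sub_le J (f ω) 0
  have h4 := abs_add_le (meanNorm J (f ω) - meanNorm J 0) (meanNorm J 0)
  rw [sub_add_cancel] at h4
  rw [sub_zero] at h3
  linarith

end MeanNorm

/-! ### Mean square errors for a fixed mask -/

section FixedMask

variable {n K J : ℕ} {b : Fin n → ℝ}

lemma sum_one_sub_mask (hKJ : K + J = n) (hK : ∑ i, b i = (K : ℝ)) :
    ∑ i, (1 - b) i = (J : ℝ) := by
  have : (n : ℝ) = K + J := by exact_mod_cast hKJ.symm
  simp [Finset.sum_sub_distrib, hK, this]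

lemma mask_compl_zero_or_one (hb : ∀ i, b i = 0 ∨ b i = 1) (i : Fin n) :
    (1 - b) i = 0 ∨ (1 - b) i = 1 := by
  rcases hb i with h | h <;> simp [h]

lemma integral_comp_norm_mask (hb : ∀ i, b i = 0 ∨ b i = 1) (hK : ∑ i, b i = (K : ℝ)) {φ : ℝ → ℝ}
    (hφ : Measurable φ) :
    ∫ x, φ ‖mask b x‖ ∂stdGaussian (EuclideanSpace ℝ (Fin n)) =
      ∫ x, φ ‖x‖ ∂stdGaussian (EuclideanSpace ℝ (Fin K)) := by
  rw [← integral_map (φ := fun x => ‖mask b x‖) (by fun_prop) hφ.aestronglyMeasurable,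
    map_norm_mask_stdGaussian hb hK, integral_map (by fun_prop) hφ.aestronglyMeasurable]

lemma norm_mask_add_mask_compl (hb : ∀ i, b i = 0 ∨ b i = 1) (x y : EuclideanSpace ℝ (Fin n)) :
    ‖mask b x + mask (1 - b) y‖ = √(‖mask b x‖ ^ 2 + ‖mask (1 - b) y‖ ^ 2) := by
  rw [← norm_mask_add_sq hb, Real.sqrt_sq (norm_nonneg _)]

lemma integrable_comp_mask_add (hb : ∀ i, b i = 0 ∨ b i = 1) {F : EuclideanSpace ℝ (Fin n) → ℝ}
    (hF : Integrable F (stdGaussian (EuclideanSpace ℝ (Fin n)))) :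
    Integrable (fun p : EuclideanSpace ℝ (Fin n) × EuclideanSpace ℝ (Fin n) =>
      F (mask b p.1 + mask (1 - b) p.2)) ((stdGaussian (EuclideanSpace ℝ (Fin n))).prod
        (stdGaussian (EuclideanSpace ℝ (Fin n)))) :=
  (measurePreserving_mask_add hb).integrable_comp_of_integrable hF

lemma integral_comp_mask_add (hb : ∀ i, b i = 0 ∨ b i = 1) {F : EuclideanSpace ℝ (Fin n) → ℝ}
    (hF : Integrable F (stdGaussian (EuclideanSpace ℝ (Fin n)))) :
    ∫ x, F x ∂stdGaussian (EuclideanSpace ℝ (Fin n)) =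
      ∫ x, ∫ y, F (mask b x + mask (1 - b) y) ∂stdGaussian (EuclideanSpace ℝ (Fin n))
        ∂stdGaussian (EuclideanSpace ℝ (Fin n)) := by
  have hT := measurePreserving_mask_add hb
  rw [← integral_prod _ (integrable_comp_mask_add hb hF)]
  conv_lhs => rw [← hT.map_eq]
  rw [integral_map hT.measurable.aemeasurable]
  rw [hT.map_eq]
  exact hF.1

lemma integral_norm_mask_add (hb : ∀ i, b i = 0 ∨ b i = 1) (hKJ : K + J = n)
    (hK : ∑ i, b i = (K : ℝ)) (x : EuclideanSpace ℝ (Fin n)) :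
    ∫ y, ‖mask b x + mask (1 - b) y‖ ∂stdGaussian (EuclideanSpace ℝ (Fin n)) =
      meanNorm J ‖mask b x‖ := by
  simp_rw [norm_mask_add_mask_compl hb]
  exact integral_comp_norm_mask (mask_compl_zero_or_one hb) (sum_one_sub_mask hKJ hK)
    (φ := fun t => √(‖mask b x‖ ^ 2 + t ^ 2)) (by fun_prop)

lemma memLp_norm_mask (b : Fin n → ℝ) :
    MemLp (fun x => ‖mask b x‖) 2 (stdGaussian (EuclideanSpace ℝ (Fin n))) :=
  ((mask b).comp_memLp' (IsGaussian.memLp_id (stdGaussian (EuclideanSpace ℝ (Fin n))) 2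
    (by norm_num))).norm

lemma memLp_norm_mask_add (hb : ∀ i, b i = 0 ∨ b i = 1) (x : EuclideanSpace ℝ (Fin n)) :
    MemLp (fun y => ‖mask b x + mask (1 - b) y‖) 2 (stdGaussian (EuclideanSpace ℝ (Fin n))) := by
  simp_rw [norm_mask_add_mask_compl hb]
  exact memLp_sqrt_add_sq (memLp_norm_mask (1 - b)) _

lemma integral_meanNorm_mask_sq (hb : ∀ i, b i = 0 ∨ b i = 1) (hK : ∑ i, b i = (K : ℝ)) :
    ∫ x, meanNorm J ‖mask b x‖ ^ 2 ∂stdGaussian (EuclideanSpace ℝ (Fin n)) = meanNormSq K J :=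
  integral_comp_norm_mask hb hK (φ := fun t => meanNorm J t ^ 2)
    ((continuous_meanNorm J).measurable.pow_const 2)

/-- Decomposition of the mean square error of an estimator of the norm from the coordinates
selected by `b`. -/
lemma integral_norm_sub_mask_sq [NeZero n] (hb : ∀ i, b i = 0 ∨ b i = 1) (hKJ : K + J = n)
    (hK : ∑ i, b i = (K : ℝ)) {v : EuclideanSpace ℝ (Fin n) → ℝ}
    (hint : Integrable (fun x => (‖x‖ - v (mask b x)) ^ 2)
      (stdGaussian (EuclideanSpace ℝ (Fin n)))) :
    ∫ x, (‖x‖ - v (mask b x)) ^ 2 ∂stdGaussian (EuclideanSpace ℝ (Fin n)) =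
      n - meanNormSq K J + ∫ x, (meanNorm J ‖mask b x‖ - v (mask b x)) ^ 2
        ∂stdGaussian (EuclideanSpace ℝ (Fin n)) := by
  set γ := stdGaussian (EuclideanSpace ℝ (Fin n)) with hγ
  have hsq : Integrable (fun x : EuclideanSpace ℝ (Fin n) => ‖x‖ ^ 2) γ :=
    (memLp_norm_stdGaussian 2 (by norm_num)).integrable_sq
  have hn : ∫ x, ‖x‖ ^ 2 ∂γ = n := by
    have := integral_norm_sq_stdGaussian (E := EuclideanSpace ℝ (Fin n))
    rwa [finrank_euclideanSpace_fin] at this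
  have hg : Integrable (fun x => meanNorm J ‖mask b x‖ ^ 2) γ :=
    (memLp_meanNorm J (memLp_norm_mask b)).integrable_sq
  have hS := (integrable_comp_mask_add hb hsq).integral_prod_left
  have hE := (integrable_comp_mask_add hb hint).integral_prod_left
  have hinner : ∀ x, ∫ y, (‖mask b x + mask (1 - b) y‖ -
      v (mask b (mask b x + mask (1 - b) y))) ^ 2 ∂γ =
      (∫ y, ‖mask b x + mask (1 - b) y‖ ^ 2 ∂γ) - meanNorm J ‖mask b x‖ ^ 2 +
        (meanNorm J ‖mask b x‖ - v (mask b x)) ^ 2 := by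
    -- With x fixed the estimator is constant in y, so this is the split into variance and squared
    -- bias.
    intro x
    simp_rw [mask_mask_add_mask_compl hb]
    rw [integral_sub_const_sq (memLp_norm_mask_add hb x), integral_norm_mask_add hb hKJ hK]
  replace hE : Integrable (fun x => (∫ y, ‖mask b x + mask (1 - b) y‖ ^ 2 ∂γ) -
      meanNorm J ‖mask b x‖ ^ 2 + (meanNorm J ‖mask b x‖ - v (mask b x)) ^ 2) γ :=
    hE.congr (.of_forall hinner)
  have hD : Integrable (fun x => (∫ y, ‖mask b x + mask (1 - b) y‖ ^ 2 ∂γ) -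
      meanNorm J ‖mask b x‖ ^ 2) γ := hS.sub hg
  -- About `v` only `hint` is known, so this integrability is obtained by subtraction.
  have hR : Integrable (fun x => (meanNorm J ‖mask b x‖ - v (mask b x)) ^ 2) γ := by
    refine (hE.sub hD).congr (.of_forall fun x => ?_)
    simp
  rw [integral_comp_mask_add hb hint, integral_congr_ae (.of_forall hinner), integral_add hD hR, integral_sub hS hg, ← integral_comp_mask_add hb hsq, hn,
    integral_meanNorm_mask_sq hb hK]

lemma integral_norm_sub_meanNorm_mask_sq [NeZero n] (hb : ∀ i, b i = 0 ∨ b i = 1)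
    (hKJ : K + J = n) (hK : ∑ i, b i = (K : ℝ)) :
    ∫ x, (‖x‖ - meanNorm J ‖mask b x‖) ^ 2 ∂stdGaussian (EuclideanSpace ℝ (Fin n)) =
      n - meanNormSq K J := by
  have h := integral_norm_sub_mask_sq hb hKJ hK (v := fun x => meanNorm J ‖x‖)
    ((memLp_norm_stdGaussian 2 (by norm_num)).sub
      (memLp_meanNorm J (memLp_norm_mask b))).integrable_sq
  simpa using h

/-- For each frozen noise vector z the map x ↦ v(x + σz) is an estimator from the observed
coordinates, and none of these beats `meanNorm`. -/
lemma le_integral_norm_sub_mask_add_noise [NeZero n] (hb : ∀ i, b i = 0 ∨ b i = 1)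
    (hKJ : K + J = n) (hK : ∑ i, b i = (K : ℝ)) (σ : ℝ) {v : EuclideanSpace ℝ (Fin n) → ℝ}
    (hint : Integrable (fun p : EuclideanSpace ℝ (Fin n) × EuclideanSpace ℝ (Fin n) =>
        (‖p.1‖ - v (mask b p.1 + σ • p.2)) ^ 2)
        ((stdGaussian (EuclideanSpace ℝ (Fin n))).prod
          (stdGaussian (EuclideanSpace ℝ (Fin n))))) :
    n - meanNormSq K J ≤ ∫ p, (‖p.1‖ - v (mask b p.1 + σ • p.2)) ^ 2
        ∂((stdGaussian (EuclideanSpace ℝ (Fin n))).prod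
          (stdGaussian (EuclideanSpace ℝ (Fin n)))) := by
  rw [integral_prod_symm _ hint]
  calc (n - meanNormSq K J : ℝ) =
      ∫ _, (n - meanNormSq K J : ℝ) ∂stdGaussian (EuclideanSpace ℝ (Fin n)) := by simp
    _ ≤ _ := by
      refine integral_mono_ae (integrable_const _) hint.integral_prod_right ?_
      filter_upwards [hint.prod_left_ae] with z hz
      simp only
      rw [integral_norm_sub_mask_sq hb hKJ hK (v := fun x => v (x + σ • z))
        hz]
      have : 0 ≤ ∫ x, (meanNorm J ‖mask b x‖ - v (mask b x + σ • z)) ^ 2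
        ∂stdGaussian (EuclideanSpace ℝ (Fin n)) := integral_nonneg fun _ => sq_nonneg _
      linarith

/-- The mean square error in strong noise: a rotation turns the measurement into a function of
a vector independent of another one that is close to the input. -/
lemma sqrt_variance_sub_le [NeZero n] (hb : ∀ i, b i = 0 ∨ b i = 1) {s c : ℝ}
    (hsc : s ^ 2 + c ^ 2 = 1) (hs1 : s ≤ 1) (hc : 0 < c)
    {v : EuclideanSpace ℝ (Fin n) → ℝ} (hv : Measurable v)
    (hint : Integrable (fun p : EuclideanSpace ℝ (Fin n) × EuclideanSpace ℝ (Fin n) =>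
        (‖p.1‖ - v (mask b p.1 + (s / c) • p.2)) ^ 2)
        ((stdGaussian (EuclideanSpace ℝ (Fin n))).prod
          (stdGaussian (EuclideanSpace ℝ (Fin n))))) :
    √(n - (∫ x, ‖x‖ ∂stdGaussian (EuclideanSpace ℝ (Fin n))) ^ 2) - ((1 - s) * √n + c * √n) ≤
      √(∫ p, (‖p.1‖ - v (mask b p.1 + (s / c) • p.2)) ^ 2
        ∂((stdGaussian (EuclideanSpace ℝ (Fin n))).prod
          (stdGaussian (EuclideanSpace ℝ (Fin n))))) := by
  set γ := stdGaussian (EuclideanSpace ℝ (Fin n)) with hγ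
  have hT := measurePreserving_mask_rotation hb hsc
  set T : EuclideanSpace ℝ (Fin n) × EuclideanSpace ℝ (Fin n) →
    EuclideanSpace ℝ (Fin n) × EuclideanSpace ℝ (Fin n) := fun p =>
      (mask b (s • p.1 + c • p.2) + mask (1 - b) p.1,
        mask b (s • p.2 - c • p.1) + mask (1 - b) p.2) with hTdef
  have hn : ∫ x, ‖x‖ ^ 2 ∂γ = n := by
    have := integral_norm_sq_stdGaussian (E := EuclideanSpace ℝ (Fin n))
    rwa [finrank_euclideanSpace_fin] at this
  have hnorm : MemLp (fun x : EuclideanSpace ℝ (Fin n) => ‖x‖) 2 γ :=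
    memLp_norm_stdGaussian 2 (by norm_num)
  have hn1 : MemLp (fun p : EuclideanSpace ℝ (Fin n) × EuclideanSpace ℝ (Fin n) => ‖p.1‖) 2
      (γ.prod γ) := hnorm.comp_measurePreserving measurePreserving_fst
  have hn2 : MemLp (fun p : EuclideanSpace ℝ (Fin n) × EuclideanSpace ℝ (Fin n) => ‖p.2‖) 2
      (γ.prod γ) := hnorm.comp_measurePreserving measurePreserving_snd
  have e1 : ∫ p : EuclideanSpace ℝ (Fin n) × EuclideanSpace ℝ (Fin n),
      ((1 - s) * ‖p.1‖) ^ 2 ∂(γ.prod γ) = ((1 - s) * √n) ^ 2 := by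
    rw [integral_fun_fst (fun x => ((1 - s) * ‖x‖) ^ 2)]
    simp_rw [mul_pow]
    rw [integral_const_mul, hn]
    simp
  have e2 : ∫ p : EuclideanSpace ℝ (Fin n) × EuclideanSpace ℝ (Fin n),
      (c * ‖p.2‖) ^ 2 ∂(γ.prod γ) = (c * √n) ^ 2 := by
    rw [integral_fun_snd (fun x => (c * ‖x‖) ^ 2)]
    simp_rw [mul_pow]
    rw [integral_const_mul, hn]
    simp
  -- the measurement after rotation
  set w : EuclideanSpace ℝ (Fin n) → EuclideanSpace ℝ (Fin n) := fun z =>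
    (c + s / c * s) • mask b z + (s / c) • mask (1 - b) z with hw
  -- On the observed coordinates the contribution of `p.1` is s − (s/c)c = 0; this cancellation is
  -- why the rotation is tied to the noise level s/c.
  have hY : ∀ p, mask b (T p).1 + (s / c) • (T p).2 = w p.2 := by
    intro p
    simp only [hTdef, hw]
    rw [mask_mask_add_mask_compl hb]
    simp only [map_add, map_sub, map_smul]
    rw [smul_add, smul_sub, smul_smul, smul_smul, div_mul_cancel₀ _ hc.ne', add_smul]
    abel
  set k : EuclideanSpace ℝ (Fin n) × EuclideanSpace ℝ (Fin n) → ℝ :=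
    fun p => ‖(T p).1‖ - v (w p.2) with hk
  have hvw : Measurable fun p : EuclideanSpace ℝ (Fin n) × EuclideanSpace ℝ (Fin n) =>
      v (w p.2) := hv.comp (by fun_prop)
  have hkm : Measurable k := (hT.measurable.fst.norm).sub hvw
  have hk_int : Integrable (fun p => k p ^ 2) (γ.prod γ) := by
    have h := hT.integrable_comp_of_integrable hint
    refine h.congr (.of_forall fun p => ?_)
    simp only [Function.comp_apply, hk, ← hY p]
  have hkL : MemLp k 2 (γ.prod γ) :=
    (memLp_two_iff_integrable_sq hkm.aestronglyMeasurable).2 hk_int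
  have hk_eq : ∫ p, (‖p.1‖ - v (mask b p.1 + (s / c) • p.2)) ^ 2 ∂(γ.prod γ) =
      ∫ p, k p ^ 2 ∂(γ.prod γ) := by
    conv_lhs => rw [hγ, ← hT.map_eq]
    rw [integral_map hT.measurable.aemeasurable]
    · refine integral_congr_ae (.of_forall fun p => ?_)
      simp only [hk, ← hY p]
    · rw [hT.map_eq]
      exact hint.1
  have hdiff : ∀ p : EuclideanSpace ℝ (Fin n) × EuclideanSpace ℝ (Fin n),
      |‖p.1‖ - ‖(T p).1‖| ≤ (1 - s) * ‖p.1‖ + c * ‖p.2‖ := by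
    intro p
    refine (abs_norm_sub_norm_le _ _).trans ?_
    have : p.1 - (T p).1 = mask b ((1 - s) • p.1 - c • p.2) := by
      conv_lhs => rw [← mask_add_mask_compl b p.1]
      simp only [hTdef, map_add, map_sub, map_smul, sub_smul, one_smul]
      abel
    rw [this]
    refine (norm_mask_le hb _).trans ((norm_sub_le _ _).trans ?_)
    rw [norm_smul, norm_smul, Real.norm_of_nonneg (by linarith), Real.norm_of_nonneg hc.le]
  have hδL : MemLp (fun p : EuclideanSpace ℝ (Fin n) × EuclideanSpace ℝ (Fin n) =>
      (1 - s) * ‖p.1‖ + c * ‖p.2‖) 2 (γ.prod γ) := (hn1.const_mul _).add (hn2.const_mul _)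
  have hδ : √(∫ p : EuclideanSpace ℝ (Fin n) × EuclideanSpace ℝ (Fin n),
      ((1 - s) * ‖p.1‖ + c * ‖p.2‖) ^ 2 ∂(γ.prod γ)) ≤ (1 - s) * √n + c * √n := by
    have h := sqrt_integral_sq_le_add (hn1.const_mul (1 - s)) (hn2.const_mul c) hδL.1
      (fun p => abs_add_le _ _)
    rwa [e1, e2, Real.sqrt_sq (mul_nonneg (by linarith) (by positivity)),
      Real.sqrt_sq (by positivity)] at h
  have hmain : √(∫ p : EuclideanSpace ℝ (Fin n) × EuclideanSpace ℝ (Fin n),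
      (‖p.1‖ - v (w p.2)) ^ 2 ∂(γ.prod γ)) ≤ √(∫ p, k p ^ 2 ∂(γ.prod γ)) +
      √(∫ p : EuclideanSpace ℝ (Fin n) × EuclideanSpace ℝ (Fin n),
      ((1 - s) * ‖p.1‖ + c * ‖p.2‖) ^ 2 ∂(γ.prod γ)) := by
    refine sqrt_integral_sq_le_add hkL hδL
      (Measurable.aestronglyMeasurable (by fun_prop)) fun p => ?_
    have h1 := hdiff p
    have h2 := abs_add_le (k p) (‖p.1‖ - ‖(T p).1‖)
    have h3 : k p + (‖p.1‖ - ‖(T p).1‖) = ‖p.1‖ - v (w p.2) := by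
      simp only [hk]
      ring
    rw [h3] at h2
    exact h2.trans (add_le_add le_rfl (h1.trans (le_abs_self _)))
  have hfin : Integrable (fun p : EuclideanSpace ℝ (Fin n) × EuclideanSpace ℝ (Fin n) =>
      (‖p.1‖ - v (w p.2)) ^ 2) (γ.prod γ) := by
    refine MemLp.integrable_sq (MemLp.mono (hkL.abs.add hδL)
      (Measurable.aestronglyMeasurable (by fun_prop)) (.of_forall fun p => ?_))
    have h1 := hdiff p
    have h2 := abs_add_le (k p) (‖p.1‖ - ‖(T p).1‖)
    have h3 : k p + (‖p.1‖ - ‖(T p).1‖) = ‖p.1‖ - v (w p.2) := by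
      simp only [hk]
      ring
    rw [h3] at h2
    exact h2.trans ((add_le_add le_rfl h1).trans (le_abs_self _))
  -- For fixed second component the estimator is a constant, so the error is at least the variance
  -- of the norm.
  have hvar : n - (∫ x, ‖x‖ ∂γ) ^ 2 ≤ ∫ p : EuclideanSpace ℝ (Fin n) × EuclideanSpace ℝ (Fin n),
      (‖p.1‖ - v (w p.2)) ^ 2 ∂(γ.prod γ) := by
    rw [integral_prod_symm _ hfin]
    calc n - (∫ x, ‖x‖ ∂γ) ^ 2 = ∫ _, (n - (∫ x, ‖x‖ ∂γ) ^ 2) ∂γ := by simp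
      _ ≤ _ := by
        refine integral_mono (integrable_const _) hfin.integral_prod_right fun z => ?_
        simp only
        rw [integral_sub_const_sq hnorm, hn]
        nlinarith [sq_nonneg (∫ x, ‖x‖ ∂γ - v (w z))]
  rw [hk_eq]
  have := Real.sqrt_le_sqrt hvar
  linarith

end FixedMask

/-! ### The binomial series of √(1 − u) on the closed interval [0, 1] -/

section SqrtSeries

/-- The coefficients of the power series of `√(1 - u)`. -/
noncomputable def sqrtCoeff (k : ℕ) : ℝ := (ascPochhammer ℝ k).eval (-(1 / 2)) / k.factorial

lemma hasSum_sqrtCoeff_of_lt {u : ℝ} (hu0 : 0 ≤ u) (hu : u < 1) :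
    HasSum (fun k => sqrtCoeff k * u ^ k) √(1 - u) := by
  have h := (Real.one_div_one_sub_rpow_hasFPowerSeriesOnBall_zero (-(1 / 2))).hasSum (y := u)
    (by simpa [Metric.mem_eball, edist_eq_enorm_sub, ← ofReal_norm, abs_of_nonneg hu0]
      using hu)
  have h1 : 1 / (1 - (0 + u)) ^ (-(1 / 2) : ℝ) = √(1 - u) := by
    rw [zero_add, Real.rpow_neg (by linarith), one_div, inv_inv, Real.sqrt_eq_rpow]
  rw [h1] at h
  have key : ∀ k : ℕ, sqrtCoeff k = Ring.choose (-(1 / 2) + (k : ℝ) - 1) k := by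
    intro k
    rw [← Ring.multichoose_eq, sqrtCoeff, div_eq_iff (by positivity),
      ← Polynomial.ascPochhammer_smeval_eq_eval,
      ← Ring.factorial_nsmul_multichoose_eq_ascPochhammer, nsmul_eq_mul, mul_comm]
  simp only [FormalMultilinearSeries.ofScalars_apply_eq, smul_eq_mul] at h
  simp_rw [key]
  exact h

lemma sqrtCoeff_zero : sqrtCoeff 0 = 1 := by simp [sqrtCoeff]

lemma sqrtCoeff_succ_nonpos (k : ℕ) : sqrtCoeff (k + 1) ≤ 0 := by
  have h : (ascPochhammer ℝ (k + 1)).eval (-(1 / 2)) =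
      -(1 / 2) * (ascPochhammer ℝ k).eval (1 / 2) := by
    rw [ascPochhammer_succ_left]
    norm_num [Polynomial.eval_comp]
  have h2 : 0 < (ascPochhammer ℝ k).eval (1 / 2) := ascPochhammer_pos k _ (by norm_num)
  rw [sqrtCoeff, h]
  apply div_nonpos_of_nonpos_of_nonneg
  · nlinarith
  · positivity

/-- All coefficients after the first are nonpositive, so for u < 1 the partial sums of their
absolute values against powers of u are at most 1 − √(1 − u) ≤ 1; let u → 1. -/
lemma summable_abs_sqrtCoeff : Summable fun k => |sqrtCoeff k| := by
  rw [← summable_nat_add_iff 1]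
  refine summable_of_sum_range_le (c := 1) (fun k => abs_nonneg _) fun m => ?_
  have hle : ∀ u ∈ Set.Ioo (0 : ℝ) 1,
      ∑ k ∈ Finset.range m, |sqrtCoeff (k + 1)| * u ^ (k + 1) ≤ 1 := by
    intro u hu
    have h := hasSum_sqrtCoeff_of_lt hu.1.le hu.2
    have h2 := (hasSum_nat_add_iff' 1).2 h
    have h3 := h2.neg
    have h4 := sum_le_hasSum (Finset.range m) (fun k _ => by
      have := sqrtCoeff_succ_nonpos k
      have := pow_nonneg hu.1.le (k + 1)
      nlinarith) h3
    simp only [Finset.range_one, Finset.sum_singleton, sqrtCoeff_zero, pow_zero, mul_one] at h4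
    refine le_trans (le_of_eq ?_) (h4.trans (by linarith [Real.sqrt_nonneg (1 - u)]))
    refine Finset.sum_congr rfl fun k _ => ?_
    rw [abs_of_nonpos (sqrtCoeff_succ_nonpos k)]
    ring
  have hcont : Continuous fun u : ℝ => ∑ k ∈ Finset.range m, |sqrtCoeff (k + 1)| * u ^ (k + 1) := by
    fun_prop
  have hlim := (hcont.tendsto 1).mono_left (nhdsWithin_le_nhds (s := Set.Iio 1))
  simp only [one_pow, mul_one] at hlim
  refine le_of_tendsto hlim ?_
  filter_upwards [Ioo_mem_nhdsLT (zero_lt_one' ℝ)] with u hu using hle u hu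

/-- Absolute summability of the coefficients makes the series continuous on [0, 1], so the identity
extends from the dense set u < 1 to the endpoint. -/
lemma hasSum_sqrtCoeff {u : ℝ} (hu0 : 0 ≤ u) (hu : u ≤ 1) :
    HasSum (fun k => sqrtCoeff k * u ^ k) √(1 - u) := by
  have hbound : ∀ (k : ℕ) (u : Set.Icc (0 : ℝ) 1), ‖sqrtCoeff k * (u : ℝ) ^ k‖ ≤ |sqrtCoeff k| := by
    intro k u
    rw [norm_mul, Real.norm_eq_abs, Real.norm_of_nonneg (pow_nonneg u.2.1 k)]
    exact mul_le_of_le_one_right (abs_nonneg _) (pow_le_one₀ u.2.1 u.2.2)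
  have hsum : ∀ u : Set.Icc (0 : ℝ) 1, Summable fun k => sqrtCoeff k * (u : ℝ) ^ k := fun u =>
    Summable.of_norm_bounded summable_abs_sqrtCoeff fun k => hbound k u
  rcases hu.lt_or_eq with h | rfl
  · exact hasSum_sqrtCoeff_of_lt hu0 h
  have hcont : Continuous fun u : Set.Icc (0 : ℝ) 1 => ∑' k, sqrtCoeff k * (u : ℝ) ^ k :=
    continuous_tsum (fun k => by fun_prop) summable_abs_sqrtCoeff hbound
  have hcont2 : Continuous fun u : Set.Icc (0 : ℝ) 1 => √(1 - (u : ℝ)) := by fun_prop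
  have hdense : Dense {u : Set.Icc (0 : ℝ) 1 | (u : ℝ) < 1} := by
    have : {u : Set.Icc (0 : ℝ) 1 | (u : ℝ) < 1} = {1}ᶜ := by
      ext u
      simp only [Set.mem_ofPred_eq, Set.mem_compl_iff, Set.mem_singleton_iff]
      rw [← Subtype.coe_inj]
      exact ⟨fun h => h.ne, fun h => lt_of_le_of_ne u.2.2 h⟩
    rw [this]
    exact dense_compl_singleton _
  have heq := Continuous.ext_on hdense hcont hcont2 fun u hu =>
    (hasSum_sqrtCoeff_of_lt u.2.1 hu).tsum_eq
  have h1 := congrFun heq ⟨1, hu0, hu⟩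
  rw [← h1]
  exact (hsum ⟨1, hu0, hu⟩).hasSum

end SqrtSeries

/-! ### Rising factorials and even moments -/

section Moments

lemma Gamma_add_nat_eq_ascPochhammer {a : ℝ} (ha : 0 < a) (k : ℕ) :
    Real.Gamma (a + k) = (ascPochhammer ℝ k).eval a * Real.Gamma a := by
  induction k with
  | zero => simp
  | succ k ih =>
    push_cast
    rw [← add_assoc, Real.Gamma_add_one (by positivity), ih, ascPochhammer_succ_eval]
    ring

/-- The even moments of the norm of a standard Gaussian vector, in any dimension. -/
lemma integral_norm_pow_even_stdGaussian (J k : ℕ) :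
    ∫ x, ‖x‖ ^ (2 * k) ∂stdGaussian (EuclideanSpace ℝ (Fin J)) =
      2 ^ k * (ascPochhammer ℝ k).eval ((J : ℝ) / 2) := by
  rcases J.eq_zero_or_pos with rfl | hJ
  · have h : ∀ x : EuclideanSpace ℝ (Fin 0), ‖x‖ = 0 := fun x => by simp [Subsingleton.elim x 0]
    simp_rw [h]
    rcases k.eq_zero_or_pos with rfl | hk
    · simp
    · simp [hk.ne']
  · have : NeZero J := ⟨hJ.ne'⟩
    have hJ' : (0 : ℝ) < J := by exact_mod_cast hJ
    rw [integral_norm_pow_stdGaussian, finrank_euclideanSpace_fin,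
      show ((J : ℝ) + (2 * k : ℕ)) / 2 = (J : ℝ) / 2 + k by push_cast; ring,
      Gamma_add_nat_eq_ascPochhammer (by positivity)]
    have hG : Real.Gamma ((J : ℝ) / 2) ≠ 0 := (Real.Gamma_pos_of_pos (by positivity)).ne'
    rw [show (((2 * k : ℕ) : ℝ)) / 2 = k by push_cast; ring, Real.rpow_natCast]
    field_simp

end Moments

/-! ### The hypergeometric series for the second moment of `meanNorm` -/

section MeanNormSq

variable {n K J : ℕ} {b : Fin n → ℝ}

/-- Tower property: one of the two factors `meanNorm` is replaced by ‖x‖, of which it is the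
conditional mean, and the other is unfolded over a fresh Gaussian vector. This creates the dimension
n + J. -/
lemma meanNormSq_eq_integral (hb : ∀ i, b i = 0 ∨ b i = 1) (hKJ : K + J = n)
    (hK : ∑ i, b i = (K : ℝ)) :
    meanNormSq K J = ∫ p : EuclideanSpace ℝ (Fin n) × EuclideanSpace ℝ (Fin J),
      ‖p.1‖ * √(‖mask b p.1‖ ^ 2 + ‖p.2‖ ^ 2)
        ∂((stdGaussian (EuclideanSpace ℝ (Fin n))).prod
          (stdGaussian (EuclideanSpace ℝ (Fin J)))) := by
  set γ := stdGaussian (EuclideanSpace ℝ (Fin n))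
  have hn : MemLp (fun x : EuclideanSpace ℝ (Fin n) => ‖x‖) 2 γ :=
    memLp_norm_stdGaussian 2 (by norm_num)
  have hJ : MemLp (fun x : EuclideanSpace ℝ (Fin J) => ‖x‖) 2
    (stdGaussian (EuclideanSpace ℝ (Fin J))) := memLp_norm_stdGaussian 2 (by norm_num)
  have hF : Integrable (fun x => ‖x‖ * meanNorm J ‖mask b x‖) γ :=
    hn.integrable_mul (memLp_meanNorm J (memLp_norm_mask b))
  have h1 : MemLp (fun p : EuclideanSpace ℝ (Fin n) × EuclideanSpace ℝ (Fin J) => ‖p.1‖) 2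
      (γ.prod (stdGaussian (EuclideanSpace ℝ (Fin J)))) :=
    hn.comp_measurePreserving measurePreserving_fst
  have h2 : MemLp (fun p : EuclideanSpace ℝ (Fin n) × EuclideanSpace ℝ (Fin J) => ‖p.2‖) 2
      (γ.prod (stdGaussian (EuclideanSpace ℝ (Fin J)))) :=
    hJ.comp_measurePreserving measurePreserving_snd
  have h3 : MemLp (fun p : EuclideanSpace ℝ (Fin n) × EuclideanSpace ℝ (Fin J) =>
      √(‖mask b p.1‖ ^ 2 + ‖p.2‖ ^ 2)) 2 (γ.prod (stdGaussian (EuclideanSpace ℝ (Fin J)))) := by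
    refine (h1.add h2).mono (Measurable.aestronglyMeasurable (by fun_prop))
      (.of_forall fun p => ?_)
    rw [Real.norm_of_nonneg (Real.sqrt_nonneg _), Pi.add_apply, Real.norm_of_nonneg (by positivity)]
    have := norm_mask_le hb p.1
    refine Real.sqrt_le_iff.2 ⟨by positivity, ?_⟩
    nlinarith [norm_nonneg p.1, norm_nonneg p.2, norm_nonneg (mask b p.1),
      mul_nonneg (norm_nonneg p.1) (norm_nonneg p.2)]
  have hG : Integrable (fun p : EuclideanSpace ℝ (Fin n) × EuclideanSpace ℝ (Fin J) =>
      ‖p.1‖ * √(‖mask b p.1‖ ^ 2 + ‖p.2‖ ^ 2)) (γ.prod (stdGaussian (EuclideanSpace ℝ (Fin J)))) :=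
    h1.integrable_mul h3
  rw [integral_prod _ hG]
  simp_rw [integral_const_mul]
  change _ = ∫ x, ‖x‖ * meanNorm J ‖mask b x‖ ∂γ
  rw [integral_comp_mask_add hb hF, ← integral_meanNorm_mask_sq hb hK]
  congr 1 with x
  simp_rw [mask_mask_add_mask_compl hb]
  rw [integral_mul_const, integral_norm_mask_add hb hKJ hK, sq]

/-- The moments that arise from the power series of the square root. -/
lemma integral_mul_norm_mul_pow [NeZero n] (hb : ∀ i, b i = 0 ∨ b i = 1) (hKJ : K + J = n)
    (hK : ∑ i, b i = (K : ℝ)) (k : ℕ) :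
    ∫ v : WithLp 2 (EuclideanSpace ℝ (Fin n) × EuclideanSpace ℝ (Fin J)),
      ‖v.fst‖ * ‖v‖ * ((‖mask (1 - b) v.fst‖ / ‖v‖) ^ 2) ^ k
        ∂stdGaussian (WithLp 2 (EuclideanSpace ℝ (Fin n) × EuclideanSpace ℝ (Fin J))) =
      (n + J) * (Real.Gamma (((n : ℝ) + 1) / 2) * Real.Gamma (((n : ℝ) + J) / 2) /
        (Real.Gamma ((n : ℝ) / 2) * Real.Gamma (((n : ℝ) + J + 1) / 2))) *
      ((ascPochhammer ℝ k).eval (((n : ℝ) + 1) / 2) * (ascPochhammer ℝ k).eval ((J : ℝ) / 2) /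
        ((ascPochhammer ℝ k).eval (((n : ℝ) + J + 1) / 2) *
          (ascPochhammer ℝ k).eval ((n : ℝ) / 2))) := by
  set γ := stdGaussian (EuclideanSpace ℝ (Fin n))
  set V := WithLp 2 (EuclideanSpace ℝ (Fin n) × EuclideanSpace ℝ (Fin J))
  have hn0 : (0 : ℝ) < n := by exact_mod_cast NeZero.pos n
  have hdim : Module.finrank ℝ V = n + J := by
    rw [(WithLp.prodContinuousLinearEquiv 2 ℝ _ _).toLinearEquiv.finrank_eq]
    simp
  have hV : Nontrivial V := Module.nontrivial_of_finrank_pos (R := ℝ) (by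
    rw [hdim]
    have := NeZero.pos n
    omega)
  have hfst : ∀ v : V, ‖v‖ = 0 → ‖v.fst‖ = 0 := fun v hv => by
    have := WithLp.prod_norm_sq_eq_of_L2 v
    rw [hv] at this
    nlinarith [sq_nonneg ‖v.fst‖, sq_nonneg ‖v.snd‖]
  -- Functions of the direction only. The mean of `h₀` is found by multiplying with ‖v‖^(2k+1),
  -- which clears its denominators and leaves an integral over x; that integral is treated likewise
  -- with `h₁`, whose mean comes from the even moments.
  let h₀ : V → ℝ := fun v => ‖v.fst‖ / ‖v‖ * ((‖mask (1 - b) v.fst‖ / ‖v‖) ^ 2) ^ k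
  have hh₀ : ∀ (r : ℝ) (v : V), 0 < r → h₀ (r • v) = h₀ v := by
    intro r v hr
    have hfst_smul : (r • v).fst = r • v.fst := rfl
    simp only [h₀, hfst_smul, map_smul, norm_smul, Real.norm_of_nonneg hr.le,
      mul_div_mul_left _ _ hr.ne']
  let h₁ : EuclideanSpace ℝ (Fin n) → ℝ := fun x => ((‖mask (1 - b) x‖ / ‖x‖) ^ 2) ^ k
  have hh₁ : ∀ (r : ℝ) (x : EuclideanSpace ℝ (Fin n)), 0 < r → h₁ (r • x) = h₁ x := by
    intro r v hr
    simp only [h₁, map_smul, norm_smul, Real.norm_of_nonneg hr.le, mul_div_mul_left _ _ hr.ne']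
  have hQ : ∀ x : EuclideanSpace ℝ (Fin n), ‖mask (1 - b) x‖ ≤ ‖x‖ :=
    norm_mask_le (mask_compl_zero_or_one hb)
  -- the left side
  have e1 : ∫ v : V, ‖v.fst‖ * ‖v‖ * ((‖mask (1 - b) v.fst‖ / ‖v‖) ^ 2) ^ k ∂stdGaussian V =
      (∫ v, h₀ v ∂stdGaussian V) * (n + J) := by
    have := integral_stdGaussian_angular_mul_radial h₀ (fun r => r ^ 2) hh₀
    rw [integral_norm_sq_stdGaussian, hdim] at this
    push_cast at this
    rw [← this]
    congr 1 with v
    simp only [h₀]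
    -- At the origin the quotients are 0 by convention, so the identity is checked separately there.
    rcases eq_or_ne ‖v‖ 0 with h | h
    · simp [h]
    · field_simp
  have e2 : ∫ v : V, ‖v.fst‖ * ‖mask (1 - b) v.fst‖ ^ (2 * k) ∂stdGaussian V =
      (∫ v, h₀ v ∂stdGaussian V) * ∫ v, ‖v‖ ^ (2 * k + 1) ∂stdGaussian V := by
    rw [← integral_stdGaussian_angular_mul_radial h₀ (fun r => r ^ (2 * k + 1)) hh₀]
    congr 1 with v
    simp only [h₀]
    rcases eq_or_ne ‖v‖ 0 with h | h
    · simp [h, hfst v h]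
    · rw [div_pow, div_pow, ← pow_mul, ← pow_mul, pow_succ]
      field_simp
  have e3 : ∫ v : V, ‖v.fst‖ * ‖mask (1 - b) v.fst‖ ^ (2 * k) ∂stdGaussian V =
      ∫ x, ‖x‖ * ‖mask (1 - b) x‖ ^ (2 * k) ∂γ := by
    rw [stdGaussian_withLp_prod, integral_map (by fun_prop)
      (Measurable.aestronglyMeasurable (by fun_prop))]
    simp only [WithLp.toLp_fst]
    rw [integral_fun_fst (fun x => ‖x‖ * ‖mask (1 - b) x‖ ^ (2 * k))]
    simp [γ]
  have e4 : ∫ x, ‖x‖ * ‖mask (1 - b) x‖ ^ (2 * k) ∂γ =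
      (∫ x, h₁ x ∂γ) * ∫ x, ‖x‖ ^ (2 * k + 1) ∂γ := by
    rw [← integral_stdGaussian_angular_mul_radial h₁ (fun r => r ^ (2 * k + 1)) hh₁]
    congr 1 with x
    simp only [h₁]
    rcases eq_or_ne ‖x‖ 0 with h | h
    · simp [h]
    · rw [div_pow, div_pow, ← pow_mul, ← pow_mul, pow_succ]
      field_simp
  have e5 : ∫ x, ‖mask (1 - b) x‖ ^ (2 * k) ∂γ = (∫ x, h₁ x ∂γ) * ∫ x, ‖x‖ ^ (2 * k) ∂γ := by
    rw [← integral_stdGaussian_angular_mul_radial h₁ (fun r => r ^ (2 * k)) hh₁]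
    congr 1 with x
    simp only [h₁]
    rcases eq_or_ne ‖x‖ 0 with h | h
    · have h' : ‖mask (1 - b) x‖ = 0 := le_antisymm (h ▸ hQ x) (norm_nonneg _)
      rcases k.eq_zero_or_pos with rfl | hk
      · simp
      · simp [h, h', hk.ne']
    · rw [div_pow, div_pow, ← pow_mul, ← pow_mul]
      field_simp
  rw [integral_comp_norm_mask (mask_compl_zero_or_one hb) (sum_one_sub_mask hKJ hK)
    (φ := fun t => t ^ (2 * k)) (by fun_prop), integral_norm_pow_even_stdGaussian,
    integral_norm_pow_even_stdGaussian] at e5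
  have e6 := e2.symm.trans (e3.trans e4)
  rw [integral_norm_pow_stdGaussian, integral_norm_pow_stdGaussian, hdim,
    finrank_euclideanSpace_fin, Nat.cast_add n J,
    show ((n : ℝ) + J + (2 * k + 1 : ℕ)) / 2 = ((n : ℝ) + J + 1) / 2 + k by push_cast; ring,
    show ((n : ℝ) + (2 * k + 1 : ℕ)) / 2 = ((n : ℝ) + 1) / 2 + k by push_cast; ring,
    Gamma_add_nat_eq_ascPochhammer (by positivity),
    Gamma_add_nat_eq_ascPochhammer (by positivity)] at e6
  rw [e1]
  have g1 : 0 < Real.Gamma ((n : ℝ) / 2) := Real.Gamma_pos_of_pos (by positivity)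
  have g2 : 0 < Real.Gamma (((n : ℝ) + 1) / 2) := Real.Gamma_pos_of_pos (by positivity)
  have g3 : 0 < Real.Gamma (((n : ℝ) + J) / 2) := Real.Gamma_pos_of_pos (by positivity)
  have g4 : 0 < Real.Gamma (((n : ℝ) + J + 1) / 2) := Real.Gamma_pos_of_pos (by positivity)
  have p1 : 0 < (ascPochhammer ℝ k).eval ((n : ℝ) / 2) := ascPochhammer_pos k _ (by positivity)
  have p2 : 0 < (ascPochhammer ℝ k).eval (((n : ℝ) + J + 1) / 2) :=
    ascPochhammer_pos k _ (by positivity)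
  have hc : (0 : ℝ) < 2 ^ (((2 * k + 1 : ℕ) : ℝ) / 2) := by positivity
  have f5 : ∫ x, h₁ x ∂γ =
      (ascPochhammer ℝ k).eval ((J : ℝ) / 2) / (ascPochhammer ℝ k).eval ((n : ℝ) / 2) := by
    rw [eq_div_iff p1.ne']
    have h2k : (2 : ℝ) ^ k ≠ 0 := by positivity
    apply mul_left_cancel₀ h2k
    linear_combination -e5
  rw [f5] at e6
  set c : ℝ := 2 ^ (((2 * k + 1 : ℕ) : ℝ) / 2)
  field_simp at e6 ⊢
  linear_combination e6

/-- The second moment of `meanNorm` as a hypergeometric series. -/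
lemma hasSum_meanNormSq [NeZero n] (hKJ : K + J = n) :
    HasSum (fun k => (n + J) * (ProbabilityTheory.beta (((n : ℝ) + J) / 2) (((n : ℝ) + 1) / 2) /
            ProbabilityTheory.beta (((n : ℝ) + J + 1) / 2) ((n : ℝ) / 2)) *
        hypergeometricTerm [((n : ℝ) + 1) / 2, (J : ℝ) / 2, -(1 / 2)]
            [((n : ℝ) + J + 1) / 2, (n : ℝ) / 2] 1 k) (meanNormSq K J) := by
  -- Any mask with K ones will do; the first K coordinates are chosen.
  obtain ⟨b, hb, hK⟩ : ∃ b : Fin n → ℝ, (∀ i, b i = 0 ∨ b i = 1) ∧ ∑ i, b i = (K : ℝ) := by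
    refine ⟨fun i => if (i : ℕ) < K then 1 else 0, fun i => ?_, ?_⟩
    · by_cases h : (i : ℕ) < K <;> simp [h]
    · rw [Fin.sum_univ_eq_sum_range (fun i => if i < K then (1 : ℝ) else 0) n,
        Finset.sum_ite, Finset.sum_const_zero, add_zero, Finset.sum_const, nsmul_eq_mul, mul_one]
      congr 1
      have : (Finset.range n).filter (fun i => i < K) = Finset.range K := by
        ext i
        simp
        omega
      rw [this, Finset.card_range]
  have hn0 : (0 : ℝ) < n := by exact_mod_cast NeZero.pos n
  set V := WithLp 2 (EuclideanSpace ℝ (Fin n) × EuclideanSpace ℝ (Fin J))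
  let u : V → ℝ := fun v => (‖mask (1 - b) v.fst‖ / ‖v‖) ^ 2
  have hnsq : ∀ v : V, ‖v‖ ^ 2 = ‖v.fst‖ ^ 2 + ‖v.snd‖ ^ 2 := WithLp.prod_norm_sq_eq_of_L2
  have hmsq : ∀ v : V, ‖v‖ ^ 2 - ‖mask (1 - b) v.fst‖ ^ 2 = ‖mask b v.fst‖ ^ 2 + ‖v.snd‖ ^ 2 :=
    fun v => by
      rw [hnsq, norm_sq_eq_mask_add hb v.fst]
      ring
  have hfst : ∀ v : V, ‖v.fst‖ ≤ ‖v‖ := fun v =>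
    le_of_sq_le_sq (by nlinarith [hnsq v, sq_nonneg ‖v.snd‖]) (norm_nonneg _)
  have hu0 : ∀ v, 0 ≤ u v := fun v => sq_nonneg _
  have hu1 : ∀ v, u v ≤ 1 := fun v => by
    refine pow_le_one₀ (by positivity) (div_le_one_of_le₀ ?_ (norm_nonneg _))
    exact (norm_mask_le (mask_compl_zero_or_one hb) _).trans (hfst v)
  have hVsq : Integrable (fun v : V => ‖v‖ ^ 2) (stdGaussian V) :=
    (memLp_norm_stdGaussian 2 (by norm_num)).integrable_sq
  have hbound : ∀ k (v : V), ‖sqrtCoeff k * (‖v.fst‖ * ‖v‖ * u v ^ k)‖ ≤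
      |sqrtCoeff k| * ‖v‖ ^ 2 := by
    intro k v
    rw [norm_mul, Real.norm_eq_abs, Real.norm_of_nonneg (mul_nonneg (by positivity)
      (pow_nonneg (hu0 v) k))]
    gcongr
    calc _ ≤ ‖v‖ * ‖v‖ * 1 := by
          gcongr
          · exact hfst v
          · exact pow_le_one₀ (hu0 v) (hu1 v)
      _ = ‖v‖ ^ 2 := by ring
  have hint : ∀ k, Integrable (fun v : V => sqrtCoeff k * (‖v.fst‖ * ‖v‖ * u v ^ k))
      (stdGaussian V) := fun k =>
    (hVsq.const_mul |sqrtCoeff k|).mono' (Measurable.aestronglyMeasurable (by fun_prop))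
      (.of_forall (hbound k))
  -- Since 0 ≤ u ≤ 1 and ‖v.fst‖ ≤ ‖v‖, the summable coefficients times E‖v‖² dominate; this permits
  -- termwise integration.
  have hsum : Summable fun k => ∫ v : V, ‖sqrtCoeff k * (‖v.fst‖ * ‖v‖ * u v ^ k)‖
      ∂stdGaussian V := by
    refine Summable.of_nonneg_of_le (fun k => integral_nonneg fun v => norm_nonneg _) (fun k => ?_)
      (summable_abs_sqrtCoeff.mul_right (∫ v : V, ‖v‖ ^ 2 ∂stdGaussian V))
    rw [← integral_const_mul]
    exact integral_mono (hint k).norm (hVsq.const_mul _) (hbound k)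
  have hseries := hasSum_integral_of_summable_integral_norm hint hsum
  have hpoint : ∀ v : V, ∑' k, sqrtCoeff k * (‖v.fst‖ * ‖v‖ * u v ^ k) =
      ‖v.fst‖ * √(‖mask b v.fst‖ ^ 2 + ‖v.snd‖ ^ 2) := by
    intro v
    have h := (hasSum_sqrtCoeff (hu0 v) (hu1 v)).mul_left (‖v.fst‖ * ‖v‖)
    have h2 : ‖v‖ * √(1 - u v) = √(‖mask b v.fst‖ ^ 2 + ‖v.snd‖ ^ 2) := by
      rw [← hmsq]
      rcases eq_or_ne ‖v‖ 0 with h0 | h0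
      · have := hfst v
        have h3 := norm_mask_le (mask_compl_zero_or_one hb) v.fst
        have h4 : ‖mask (1 - b) v.fst‖ = 0 := by
          apply le_antisymm _ (norm_nonneg _)
          linarith
        simp [h0, h4]
      · conv_lhs => rw [← Real.sqrt_sq (norm_nonneg v)]
        rw [← Real.sqrt_mul (sq_nonneg _)]
        congr 1
        simp only [u]
        field_simp
    rw [← h2, ← mul_assoc, ← h.tsum_eq]
    congr 1 with k
    ring
  have hval : ∫ v : V, ∑' k, sqrtCoeff k * (‖v.fst‖ * ‖v‖ * u v ^ k) ∂stdGaussian V =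
      meanNormSq K J := by
    simp_rw [hpoint]
    rw [meanNormSq_eq_integral hb hKJ hK, stdGaussian_withLp_prod, integral_map (by fun_prop)
      (Measurable.aestronglyMeasurable (by fun_prop))]
    rfl
  rw [hval] at hseries
  convert! hseries using 2 with k
  rw [integral_const_mul, integral_mul_norm_mul_pow hb hKJ hK]
  have g1 : 0 < Real.Gamma ((n : ℝ) / 2) := Real.Gamma_pos_of_pos (by positivity)
  have g4 : 0 < Real.Gamma (((n : ℝ) + J + 1) / 2) := Real.Gamma_pos_of_pos (by positivity)
  have g5 : 0 < Real.Gamma (((n : ℝ) + J) / 2 + ((n : ℝ) + 1) / 2) :=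
    Real.Gamma_pos_of_pos (by positivity)
  have p1 : 0 < (ascPochhammer ℝ k).eval ((n : ℝ) / 2) := ascPochhammer_pos k _ (by positivity)
  have p2 : 0 < (ascPochhammer ℝ k).eval (((n : ℝ) + J + 1) / 2) :=
    ascPochhammer_pos k _ (by positivity)
  have hk : (k.factorial : ℝ) ≠ 0 := by positivity
  simp only [hypergeometricTerm, ProbabilityTheory.beta, sqrtCoeff, List.map_cons, List.map_nil,
    List.prod_cons, List.prod_nil, one_pow, mul_one]
  rw [show ((n : ℝ) + J + 1) / 2 + (n : ℝ) / 2 = ((n : ℝ) + J) / 2 + ((n : ℝ) + 1) / 2 by ring]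
  field_simp

end MeanNormSq

/-! ### Limits of the mean square error -/

namespace MeasurementModel

variable {n K J : ℕ} {σ : ℝ} (M : MeasurementModel.{u} n K σ)

lemma mmse_nonneg : 0 ≤ M.mmse := integral_nonneg fun _ => sq_nonneg _

lemma integral_comp_norm_X {φ : ℝ → ℝ} (hφ : Measurable φ) :
    ∫ ω, φ ‖M.X ω‖ ∂M.P = ∫ x, φ ‖x‖ ∂stdGaussian (EuclideanSpace ℝ (Fin n)) := by
  have h : Measurable fun x : EuclideanSpace ℝ (Fin n) => φ ‖x‖ := hφ.comp measurable_norm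
  rw [← M.map_X, integral_map M.measurable_X.aemeasurable h.aestronglyMeasurable]

lemma mmse_le_integral_sub_const_sq (c : ℝ) :
    M.mmse ≤ ∫ x, (‖x‖ - c) ^ 2 ∂stdGaussian (EuclideanSpace ℝ (Fin n)) := by
  rw [← M.integral_comp_norm_X (φ := fun t => (t - c) ^ 2) (by fun_prop)]
  exact M.mmse_le (h := fun _ => c) measurable_const (memLp_const c)

lemma sub_meanNormSq_le_mmse [NeZero n] (hσ : σ ≠ 0) (hKJ : K + J = n) :
    n - meanNormSq K J ≤ M.mmse :=
  M.le_mmse hσ fun _ hb hK _ _ hint => le_integral_norm_sub_mask_add_noise hb hKJ hK σ hint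

/-- The estimator `meanNorm J ‖Y‖` is almost as good as the optimal one without noise. -/
lemma mmse_le_of_small_noise [NeZero n] (hσ : 0 < σ) (hKJ : K + J = n) :
    M.mmse ≤ (√(n - meanNormSq K J) + σ * √n) ^ 2 := by
  have hmeas : Measurable (meanNorm J) := (continuous_meanNorm J).measurable
  have hN := M.memLp_norm_N hσ.ne'
  have hmask : Measurable fun ω => mask (M.b ω) (M.X ω) :=
    measurable_mask M.measurable_b M.measurable_X
  have hB : MemLp (fun ω => ‖mask (M.b ω) (M.X ω)‖) 2 M.P := by
    refine M.memLp_norm_X.mono hmask.norm.aestronglyMeasurable (.of_forall fun ω => ?_)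
    simpa using norm_mask_le (M.b_zero_or_one ω) (M.X ω)
  have hY : MemLp (fun ω => ‖M.Y ω‖) 2 M.P := by
    refine (hB.add hN).mono M.measurable_Y.norm.aestronglyMeasurable (.of_forall fun ω => ?_)
    rw [Pi.add_apply, Real.norm_of_nonneg (by positivity), Real.norm_of_nonneg (by positivity),
      M.Y_eq]
    exact norm_add_le _ _
  have hgY := memLp_meanNorm J hY
  have hres : MemLp (fun ω => ‖M.X ω‖ - meanNorm J ‖mask (M.b ω) (M.X ω)‖) 2 M.P :=
    M.memLp_norm_X.sub (memLp_meanNorm J hB)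
  have h1 := M.mmse_le (h := fun y => meanNorm J ‖y‖) (hmeas.comp measurable_norm) hgY
  have h2 := sqrt_integral_sq_le_add (μ := M.P) hres hN
    (k := fun ω => ‖M.X ω‖ - meanNorm J ‖M.Y ω‖) (M.memLp_norm_X.sub hgY).1 fun ω => by
      have h3 := abs_meanNorm_sub_le J ‖mask (M.b ω) (M.X ω)‖ ‖M.Y ω‖
      have h4 : |‖mask (M.b ω) (M.X ω)‖ - ‖M.Y ω‖| ≤ ‖M.N ω‖ := by
        refine (abs_norm_sub_norm_le _ _).trans (le_of_eq ?_)
        rw [M.Y_eq, sub_add_cancel_left, norm_neg]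
      have h5 := abs_add_le (‖M.X ω‖ - meanNorm J ‖mask (M.b ω) (M.X ω)‖)
        (meanNorm J ‖mask (M.b ω) (M.X ω)‖ - meanNorm J ‖M.Y ω‖)
      rw [sub_add_sub_cancel] at h5
      rw [abs_norm]
      linarith
  have h6 : ∫ ω, (‖M.X ω‖ - meanNorm J ‖mask (M.b ω) (M.X ω)‖) ^ 2 ∂M.P =
      n - meanNormSq K J := by
    refine M.integral_b_X (F := fun q => (‖q.2‖ - meanNorm J ‖mask q.1 q.2‖) ^ 2) ?_
      hres.integrable_sq fun b hb hK => integral_norm_sub_meanNorm_mask_sq hb hKJ hK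
    exact ((measurable_snd.norm).sub
      (hmeas.comp (measurable_mask measurable_fst measurable_snd).norm)).pow_const 2
  have h7 : ∫ ω, ‖M.N ω‖ ^ 2 ∂M.P = (σ * √n) ^ 2 := by
    have h8 : ∫ ω, ‖σ⁻¹ • M.N ω‖ ^ 2 ∂M.P = n := by
      rw [← integral_map (φ := fun ω => σ⁻¹ • M.N ω) (f := fun x => ‖x‖ ^ 2)
        M.measurable_inv_smul_N.aemeasurable (Measurable.aestronglyMeasurable (by fun_prop)),
        M.map_inv_smul_N hσ.ne', integral_norm_sq_stdGaussian, finrank_euclideanSpace_fin]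
    simp_rw [norm_smul, mul_pow, norm_inv, inv_pow, Real.norm_eq_abs, sq_abs] at h8
    rw [integral_const_mul, inv_mul_eq_iff_eq_mul₀ (by positivity)] at h8
    rw [h8, mul_pow, Real.sq_sqrt (by positivity)]
  rw [h6, h7, Real.sqrt_sq (by positivity)] at h2
  refine h1.trans ?_
  rw [← Real.sq_sqrt (integral_nonneg fun ω => sq_nonneg (‖M.X ω‖ - meanNorm J ‖M.Y ω‖))]
  exact pow_le_pow_left₀ (Real.sqrt_nonneg _) h2 2

lemma tendsto_mmse_zero_noise [NeZero n] (hKJ : K + J = n)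
    (M : (σ : ℝ) → MeasurementModel.{u} n K σ) :
    Tendsto (fun σ : ℝ => (M σ).mmse) (𝓝[>] 0) (𝓝 (n - meanNormSq K J)) := by
  have hnonneg : 0 ≤ (n : ℝ) - meanNormSq K J := by
    -- A sample point supplies a mask with K ones, for which the number is the integral of a square.
    obtain ⟨ω⟩ : Nonempty (M 1).Ω := nonempty_of_isProbabilityMeasure (M 1).P
    rw [← integral_norm_sub_meanNorm_mask_sq ((M 1).b_zero_or_one ω) hKJ ((M 1).sum_b ω)]
    exact integral_nonneg fun _ => sq_nonneg _
  have hlim : Tendsto (fun σ : ℝ => (√(n - meanNormSq K J) + σ * √n) ^ 2) (𝓝[>] 0)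
      (𝓝 (n - meanNormSq K J)) := by
    have hc : Continuous fun σ : ℝ => (√(n - meanNormSq K J) + σ * √n) ^ 2 := by fun_prop
    have := (hc.tendsto 0).mono_left (nhdsWithin_le_nhds (s := Set.Ioi 0))
    simpa [Real.sq_sqrt hnonneg] using this
  refine tendsto_of_tendsto_of_tendsto_of_le_of_le' tendsto_const_nhds hlim ?_ ?_
  · filter_upwards [self_mem_nhdsWithin] with σ hσ
    exact (M σ).sub_meanNormSq_le_mmse (ne_of_gt hσ) hKJ
  · filter_upwards [self_mem_nhdsWithin] with σ hσ
    exact (M σ).mmse_le_of_small_noise hσ hKJ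

lemma sqrt_variance_sub_le_sqrt_mmse [NeZero n] {s c : ℝ} (hsc : s ^ 2 + c ^ 2 = 1)
    (hs : 0 < s) (hs1 : s ≤ 1) (hc : 0 < c) (hσ : σ = s / c) :
    √(n - (∫ x, ‖x‖ ∂stdGaussian (EuclideanSpace ℝ (Fin n))) ^ 2) - ((1 - s) * √n + c * √n) ≤
      √M.mmse := by
  rcases le_total (√(n - (∫ x, ‖x‖ ∂stdGaussian (EuclideanSpace ℝ (Fin n))) ^ 2) -
    ((1 - s) * √n + c * √n)) 0 with h | h
  · exact h.trans (Real.sqrt_nonneg _)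
  · refine Real.le_sqrt_of_sq_le (M.le_mmse (hσ ▸ (div_pos hs hc).ne') fun b hb _ v hv hint => ?_)
    subst hσ
    exact (Real.le_sqrt h (integral_nonneg fun _ => sq_nonneg _)).1
      (sqrt_variance_sub_le hb hsc hs1 hc hv hint)

lemma tendsto_mmse_infinite_noise [NeZero n] (M : (σ : ℝ) → MeasurementModel.{u} n K σ) :
    Tendsto (fun σ : ℝ => (M σ).mmse) atTop
      (𝓝 (n - (∫ x, ‖x‖ ∂stdGaussian (EuclideanSpace ℝ (Fin n))) ^ 2)) := by
  set V : ℝ := n - (∫ x, ‖x‖ ∂stdGaussian (EuclideanSpace ℝ (Fin n))) ^ 2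
  have hup : ∀ σ, (M σ).mmse ≤ V := by
    intro σ
    refine ((M σ).mmse_le_integral_sub_const_sq
      (∫ x, ‖x‖ ∂stdGaussian (EuclideanSpace ℝ (Fin n)))).trans (le_of_eq ?_)
    rw [integral_sub_const_sq (memLp_norm_stdGaussian 2 (by norm_num)),
      integral_norm_sq_stdGaussian, finrank_euclideanSpace_fin]
    simp [V]
  have hV : 0 ≤ V := (M 0).mmse_nonneg.trans (hup 0)
  -- The choice c = 1/√(1 + σ²), s = σc solves s² + c² = 1 and s/c = σ; as σ → ∞, s → 1 and c → 0.
  have hlow : ∀ᶠ σ : ℝ in atTop,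
      √V - ((1 - σ * (√(1 + σ ^ 2))⁻¹) * √n + (√(1 + σ ^ 2))⁻¹ * √n) ≤ √(M σ).mmse := by
    filter_upwards [eventually_gt_atTop 0] with σ hσ
    have hr : 0 < √(1 + σ ^ 2) := by positivity
    have hr2 := Real.sq_sqrt (show 0 ≤ 1 + σ ^ 2 by positivity)
    refine (M σ).sqrt_variance_sub_le_sqrt_mmse ?_ (by positivity) ?_ (by positivity) ?_
    · rw [mul_pow, ← add_one_mul, inv_pow, hr2]
      field_simp
      ring
    · rw [← div_eq_mul_inv, div_le_one hr]
      exact Real.le_sqrt_of_sq_le (by linarith)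
    · field_simp
  have hc : Tendsto (fun σ : ℝ => (√(1 + σ ^ 2))⁻¹) atTop (𝓝 0) := by
    refine tendsto_inv_atTop_zero.comp (tendsto_atTop_mono (fun σ => ?_) tendsto_id)
    exact Real.le_sqrt_of_sq_le (by simp)
  have hs : Tendsto (fun σ : ℝ => σ * (√(1 + σ ^ 2))⁻¹) atTop (𝓝 1) := by
    have h : Tendsto (fun σ : ℝ => √(1 - (√(1 + σ ^ 2))⁻¹ ^ 2)) atTop (𝓝 √(1 - 0 ^ 2)) :=
      ((hc.pow 2).const_sub 1).sqrt
    simp only [ne_eq, OfNat.ofNat_ne_zero, not_false_eq_true, zero_pow, sub_zero,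
      Real.sqrt_one] at h
    refine h.congr' ?_
    filter_upwards [eventually_gt_atTop 0] with σ hσ
    have hr2 := Real.sq_sqrt (show 0 ≤ 1 + σ ^ 2 by positivity)
    rw [Real.sqrt_eq_iff_mul_self_eq_of_pos (by positivity), ← sq, mul_pow, inv_pow, hr2]
    field_simp
    ring
  have hl : Tendsto (fun σ : ℝ =>
      √V - ((1 - σ * (√(1 + σ ^ 2))⁻¹) * √n + (√(1 + σ ^ 2))⁻¹ * √n)) atTop (𝓝 √V) := by
    have := (((hs.const_sub 1).mul_const √(n : ℝ)).add (hc.mul_const √(n : ℝ))).const_sub √V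
    simpa using this
  have hsqrt : Tendsto (fun σ : ℝ => √(M σ).mmse) atTop (𝓝 √V) :=
    tendsto_of_tendsto_of_tendsto_of_le_of_le' hl tendsto_const_nhds hlow
      (.of_forall fun σ => Real.sqrt_le_sqrt (hup σ))
  have h := hsqrt.pow 2
  rw [Real.sq_sqrt hV] at h
  exact h.congr fun σ => Real.sq_sqrt (M σ).mmse_nonneg

/-- The mean square error is at most the variance of the norm, which is bounded in the dimension. -/
lemma mmse_le_two [NeZero n] : M.mmse ≤ 2 := by
  have hn : (0 : ℝ) < n := by exact_mod_cast NeZero.pos n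
  have h2 : ∫ x, ‖x‖ ^ 2 ∂stdGaussian (EuclideanSpace ℝ (Fin n)) = n := by
    rw [integral_norm_sq_stdGaussian, finrank_euclideanSpace_fin]
  have h4 : ∫ x, ‖x‖ ^ 4 ∂stdGaussian (EuclideanSpace ℝ (Fin n)) = n * (n + 2) := by
    rw [show 4 = 2 * 2 from rfl, integral_norm_pow_even_stdGaussian]
    simp [ascPochhammer_succ_eval]
    ring
  have hL : MemLp (fun x : EuclideanSpace ℝ (Fin n) => ‖x‖) 2
      (stdGaussian (EuclideanSpace ℝ (Fin n))) := memLp_norm_stdGaussian 2 (by norm_num)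
  have hL2 : MemLp (fun x : EuclideanSpace ℝ (Fin n) => ‖x‖ ^ 2) 2
      (stdGaussian (EuclideanSpace ℝ (Fin n))) := by
    rw [memLp_two_iff_integrable_sq (Measurable.aestronglyMeasurable (by fun_prop))]
    simp_rw [← pow_mul]
    exact (memLp_norm_stdGaussian (4 : ℕ) (by norm_num)).integrable_norm_pow (by norm_num)
      |>.congr (.of_forall fun x => by simp)
  have hvar := integral_sub_const_sq hL2 (n : ℝ)
  simp_rw [← pow_mul] at hvar
  rw [h2, h4] at hvar
  -- From ‖x‖² − n = (‖x‖ + √n)(‖x‖ − √n) with first factor at least √n. The right side is the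
  -- variance 2n of ‖x‖² divided by n.
  have hle : ∫ x, (‖x‖ - √n) ^ 2 ∂stdGaussian (EuclideanSpace ℝ (Fin n)) ≤
      ∫ x, (n : ℝ)⁻¹ * (‖x‖ ^ 2 - n) ^ 2 ∂stdGaussian (EuclideanSpace ℝ (Fin n)) := by
    refine integral_mono (hL.sub (memLp_const _)).integrable_sq
      ((hL2.sub (memLp_const _)).integrable_sq.const_mul _) fun x => ?_
    simp only
    rw [le_inv_mul_iff₀ hn]
    have hs := Real.sq_sqrt hn.le
    have h1 : (‖x‖ ^ 2 - n) ^ 2 = (‖x‖ + √n) ^ 2 * (‖x‖ - √n) ^ 2 := by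
      rw [← mul_pow]
      congr 1
      linear_combination hs
    rw [h1]
    have h3 : (n : ℝ) ≤ (‖x‖ + √n) ^ 2 := by
      nlinarith [norm_nonneg x, Real.sqrt_nonneg (n : ℝ),
        mul_nonneg (norm_nonneg x) (Real.sqrt_nonneg (n : ℝ))]
    exact mul_le_mul_of_nonneg_right h3 (sq_nonneg _)
  refine (M.mmse_le_integral_sub_const_sq √n).trans (hle.trans (le_of_eq ?_))
  rw [integral_const_mul, hvar]
  field_simp
  ring

end MeasurementModel

/-! ### The three limits -/

theorem theorem3 :
    -- the limit of vanishing noise, with `J = n - K`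
    (∀ n K J : ℕ, 1 ≤ n → K + J = n → ∀ M : (σ : ℝ) → MeasurementModel.{u} n K σ,
      Summable (hypergeometricTerm [((n : ℝ) + 1) / 2, (J : ℝ) / 2, -(1 / 2)]
        [((n : ℝ) + J + 1) / 2, (n : ℝ) / 2] 1) ∧
      Tendsto (fun σ : ℝ => (M σ).mmse) (𝓝[>] 0)
        (𝓝 ((n : ℝ) - ((n : ℝ) + J) *
          (ProbabilityTheory.beta (((n : ℝ) + J) / 2) (((n : ℝ) + 1) / 2) /
            ProbabilityTheory.beta (((n : ℝ) + J + 1) / 2) ((n : ℝ) / 2)) *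
          hypergeometricPFQ [((n : ℝ) + 1) / 2, (J : ℝ) / 2, -(1 / 2)]
            [((n : ℝ) + J + 1) / 2, (n : ℝ) / 2] 1))) ∧
    -- the limit of infinite noise
    (∀ n K : ℕ, 1 ≤ n → K ≤ n → ∀ M : (σ : ℝ) → MeasurementModel.{u} n K σ,
      Tendsto (fun σ : ℝ => (M σ).mmse) atTop
        (𝓝 ((n : ℝ) - 2 * (Real.Gamma (((n : ℝ) + 1) / 2) / Real.Gamma ((n : ℝ) / 2)) ^ 2))) ∧
    -- the limit of infinite dimension; the ratio `K / n` in `[1 / n, 1]` may be constant or vary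
    (∀ σ : ℝ, 0 < σ → ∀ n K : ℕ → ℕ, Tendsto n atTop atTop →
      (∀ j, 1 ≤ K j ∧ K j ≤ n j) →
      ∀ M : (j : ℕ) → MeasurementModel.{u} (n j) (K j) σ,
        Tendsto (fun j : ℕ => (M j).mmse / (n j : ℝ)) atTop (𝓝 0)) := by

  refine ⟨fun n K J hn hKJ M => ?_, fun n K hn _ M => ?_, fun σ _ n K hn hK M => ?_⟩
  · have : NeZero n := ⟨by omega⟩
    have hn0 : (0 : ℝ) < n := by exact_mod_cast hn
    have h := hasSum_meanNormSq (n := n) hKJ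
    -- A nonzero prefactor lets summability pass from the scaled series to the hypergeometric series
    -- itself.
    have hC : ((n : ℝ) + J) * (ProbabilityTheory.beta (((n : ℝ) + J) / 2) (((n : ℝ) + 1) / 2) /
        ProbabilityTheory.beta (((n : ℝ) + J + 1) / 2) ((n : ℝ) / 2)) ≠ 0 := by
      have h1 := ProbabilityTheory.beta_pos (α := ((n : ℝ) + J) / 2) (β := ((n : ℝ) + 1) / 2)
        (by positivity) (by positivity)
      have h2 := ProbabilityTheory.beta_pos (α := ((n : ℝ) + J + 1) / 2) (β := (n : ℝ) / 2)
        (by positivity) (by positivity)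
      positivity
    refine ⟨(summable_mul_left_iff hC).1 h.summable, ?_⟩
    have hval := h.tsum_eq
    rw [tsum_mul_left] at hval
    rw [hypergeometricPFQ, hval]
    exact MeasurementModel.tendsto_mmse_zero_noise hKJ M
  · have : NeZero n := ⟨by omega⟩
    have h := MeasurementModel.tendsto_mmse_infinite_noise M
    have hmean : (∫ x, ‖x‖ ∂stdGaussian (EuclideanSpace ℝ (Fin n))) ^ 2 =
        2 * (Real.Gamma (((n : ℝ) + 1) / 2) / Real.Gamma ((n : ℝ) / 2)) ^ 2 := by
      have h1 := integral_norm_rpow_stdGaussian (E := EuclideanSpace ℝ (Fin n)) zero_le_one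
      simp only [Real.rpow_one, finrank_euclideanSpace_fin] at h1
      rw [h1, mul_div_assoc, mul_pow, ← Real.sqrt_eq_rpow, Real.sq_sqrt (by norm_num)]
    rwa [hmean] at h
  · have hcast : Tendsto (fun j => (n j : ℝ)) atTop atTop := tendsto_natCast_atTop_atTop.comp hn
    refine tendsto_of_tendsto_of_tendsto_of_le_of_le tendsto_const_nhds
      (hcast.const_div_atTop 2) (fun j => div_nonneg (M j).mmse_nonneg (Nat.cast_nonneg _))
      fun j => ?_
    have : NeZero (n j) := ⟨by have := hK j; omega⟩
    exact div_le_div_of_nonneg_right (M j).mmse_le_two (Nat.cast_nonneg _)
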